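/- Let $\beta>0$. For $N\ge 1$ let $H_\beta^{(N)}$ be the random symmetric tridiagonal $N\times N$ matrix with independent entries $a_1,\dots,a_N$ on the diagonal and $b_1,\dots,b_{N-1}$ on the two off-diagonals, where $a_j\sim \mathcal N(0,2)/\sqrt N$ (variance $2$ before scaling) and $b_j\sim\chi_{\beta j}/\sqrt N$; the matrices for all $N$ are defined on one probability space, with an arbitrary joint law for different $N$. Regard $H_\beta^{(N)}$ as the adjacency matrix of a weighted graph $G_N$ on $\{1,\dots,N\}$: distinct $i,j$ are joined by an edge of weight $(H_\beta^{(N)})_{ij}$ if this entry is nonzero, and $i$ carries a loop of weight $a_i$ (thus $G_N$ is almost surely a path with loops). Let the root $o_N$ be uniform on $\{1,\dots,N\}$ and independent of the matrix. Consider the space of isomorphism classes of connected, locally finite, rooted weighted graphs (a rooted graph being identified with the component of its root), where loops have real weights, absent loops have weight $0$, and where two rooted graphs are close if for some large $r$ their balls of radius $r$ around the root are isomorphic as rooted graphs (loops disregarded) through an isomorphism under which all edge and loop weights differ by little. Benjamini--Schramm convergence means weak convergence of the laws on this space. (i) As $N\to\infty$, the random rooted weighted graphs $(G_N,o_N)$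 converge in the Benjamini--Schramm sense to $(H_u,0)$, where $u\sim\mathrm{Unif}[0,1]$ and $H_u$ is the graph on $\mathbb Z$ in which consecutive integers are joined by edges of constant weight $\sqrt{\beta u}$ and there are no loops. This holds both for the joint randomness of matrix and root, and, for almost every realisation of the matrices, for the randomness of the root alone. (ii) For $u\in[0,1]$ let $A_u f(v)=\sqrt{\beta u}\,[f(v-1)+f(v+1)]$ be the adjacency operator of $H_u$ on $\ell^2(\mathbb Z)$, $P^{(u)}$ its projection-valued spectral measure, $\chi_0$ the indicator function of the root $0$, and $\mu_{H,u}(X)=\langle P^{(u)}_X\chi_0,\chi_0\rangle$ the spectral measure with respect to the root. The expected spectral measure $\mu_H(X)=\int_0^1\mu_{H,u}(X)\,du$ ($X\subseteq\mathbb R$ Borel) is the semicircle law $$\mu_H(dx)=\mathbf 1[x\in[-2\sqrt\beta,2\sqrt\beta]]\,\frac{\sqrt{4\beta-x^2}}{2\pi\beta}\,dx .$$ -/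

import Mathlib

open MeasureTheory ProbabilityTheory Filter Topology
open scoped ENNReal InnerProductSpace

/-! ## Weighted graphs, rooted weighted graphs and their balls -/

/-- A locally finite weighted graph on the vertex set `V`, given by its symmetric real weight
function: distinct vertices `u`, `v` are joined by an edge iff `weight u v ≠ 0`, and `v` carries a
loop iff `weight v v ≠ 0`. -/
structure WeightedGraph (V : Type) where
  weight : V → V → ℝ
  symm : ∀ u v, weight u v = weight v u
  locallyFinite : ∀ v, {u | weight v u ≠ 0}.Finite

/-- The underlying simple graph (loops are forgotten). -/
def WeightedGraph.graph {V : Type} (G : WeightedGraph V) : SimpleGraph V where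
  Adj u v := u ≠ v ∧ G.weight u v ≠ 0
  symm := ⟨fun u v h => ⟨h.1.symm, by rw [G.symm v u]; exact h.2⟩⟩
  loopless := ⟨fun _ h => h.1 rfl⟩

/-- A rooted weighted graph. Only the connected component of the root matters, see
`RootedWeightedGraph.Isomorphic`. -/
structure RootedWeightedGraph where
  V : Type
  toGraph : WeightedGraph V
  root : V

namespace RootedWeightedGraph

/-- The vertex set of the connected component of the root. -/
def component (G : RootedWeightedGraph) : Set G.V := {v | G.toGraph.graph.Reachable G.root v}

/-- The vertex set of the ball of radius `r` around the root (for the graph distance). -/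
def ball (G : RootedWeightedGraph) (r : ℕ) : Set G.V :=
  {v | ∃ p : G.toGraph.graph.Walk G.root v, p.length ≤ r}

theorem root_mem_component (G : RootedWeightedGraph) : G.root ∈ G.component :=
  SimpleGraph.Reachable.refl _

theorem root_mem_ball (G : RootedWeightedGraph) (r : ℕ) : G.root ∈ G.ball r :=
  ⟨SimpleGraph.Walk.nil, Nat.zero_le _⟩

theorem ball_mono (G : RootedWeightedGraph) {s r : ℕ} (h : s ≤ r) : G.ball s ⊆ G.ball r :=
  fun _ ⟨p, hp⟩ => ⟨p, hp.trans h⟩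

/-- Isomorphism of rooted weighted graphs: a bijection of the connected components of the roots
which maps root to root and preserves all weights (hence all edges and loops). -/
def Isomorphic (G G' : RootedWeightedGraph) : Prop :=
  ∃ e : G.component ≃ G'.component,
    e ⟨G.root, G.root_mem_component⟩ = ⟨G'.root, G'.root_mem_component⟩ ∧
    ∀ u v : G.component, G'.toGraph.weight (e u) (e v) = G.toGraph.weight u v

/-- The balls of radius `r` are isomorphic as rooted graphs, through an isomorphism under which
the weights of corresponding edges and loops differ by less than `ε`. -/
def LocallyClose (r : ℕ) (ε : ℝ) (G G' : RootedWeightedGraph) : Prop :=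
  ∃ e : G.ball r ≃ G'.ball r,
    e ⟨G.root, G.root_mem_ball r⟩ = ⟨G'.root, G'.root_mem_ball r⟩ ∧
    ∀ u v : G.ball r,
      (G.toGraph.graph.Adj u v ↔ G'.toGraph.graph.Adj (e u) (e v)) ∧
      |G.toGraph.weight u v - G'.toGraph.weight (e u) (e v)| < ε

theorem mem_ball_zero (G : RootedWeightedGraph) (v : G.V) : v ∈ G.ball 0 ↔ v = G.root := by
  constructor
  · rintro ⟨p, hp⟩
    exact (SimpleGraph.Walk.eq_of_length_eq_zero (Nat.le_zero.1 hp)).symm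
  · rintro rfl
    exact G.root_mem_ball 0

theorem mem_ball_succ (G : RootedWeightedGraph) (r : ℕ) (v : G.V) :
    v ∈ G.ball (r + 1) ↔ v ∈ G.ball r ∨ ∃ u ∈ G.ball r, G.toGraph.graph.Adj u v := by
  constructor
  · rintro ⟨p, hp⟩
    by_cases hr : p.length ≤ r
    · exact Or.inl ⟨p, hr⟩
    · right
      have hnil : ¬ p.Nil := by
        intro h
        have := SimpleGraph.Walk.length_eq_zero_iff.2 h
        omega
      refine ⟨p.penultimate, ⟨p.dropLast, ?_⟩, p.adj_penultimate hnil⟩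
      have := p.length_dropLast_add_one hnil
      omega
  · rintro (h | ⟨u, ⟨p, hp⟩, h⟩)
    · exact G.ball_mono (Nat.le_succ r) h
    · exact ⟨p.concat h, by rw [SimpleGraph.Walk.length_concat]; omega⟩

theorem LocallyClose.mono {r s : ℕ} {ε δ : ℝ} (hs : s ≤ r) (hε : ε ≤ δ)
    {G G' : RootedWeightedGraph} (h : LocallyClose r ε G G') : LocallyClose s δ G G' := by
  obtain ⟨e, he, hw⟩ := h
  have key : ∀ t, t ≤ r → ∀ v : G.ball r, (v : G.V) ∈ G.ball t ↔ (e v : G'.V) ∈ G'.ball t := by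
    intro t
    induction t with
    | zero =>
      intro _ v
      rw [mem_ball_zero, mem_ball_zero]
      constructor
      · intro hv
        have : v = ⟨G.root, G.root_mem_ball r⟩ := Subtype.ext hv
        rw [this, he]
      · intro hv
        have : e v = e ⟨G.root, G.root_mem_ball r⟩ := by rw [he]; exact Subtype.ext hv
        rw [e.injective this]
    | succ t ih =>
      intro ht v
      have iht := ih (by omega)
      rw [mem_ball_succ, mem_ball_succ]
      refine or_congr (iht v) ⟨?_, ?_⟩
      · rintro ⟨u, hu, huv⟩
        let u' : G.ball r := ⟨u, G.ball_mono (by omega) hu⟩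
        exact ⟨e u', (iht u').1 hu, (hw u' v).1.1 huv⟩
      · rintro ⟨u, hu, huv⟩
        let u' : G'.ball r := ⟨u, G'.ball_mono (by omega) hu⟩
        refine ⟨e.symm u', (iht (e.symm u')).2 (by simpa using hu), (hw (e.symm u') v).1.2 ?_⟩
        simpa using huv
  refine ⟨⟨fun v => ⟨e ⟨v, G.ball_mono hs v.2⟩, (key s hs _).1 v.2⟩,
    fun v => ⟨e.symm ⟨v, G'.ball_mono hs v.2⟩, (key s hs _).2 (by simpa using v.2)⟩,
    fun v => by simp, fun v => by simp⟩, ?_, ?_⟩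
  · apply Subtype.ext
    simp [he]
  · intro u v
    have := hw ⟨u, G.ball_mono hs u.2⟩ ⟨v, G.ball_mono hs v.2⟩
    exact ⟨this.1, this.2.trans_le hε⟩

/-- The local topology: `G'` is near `G` if, for some large `r` and small `ε`, the balls of radius
`r` around the roots are isomorphic up to an error `ε` in the weights. -/
instance : TopologicalSpace RootedWeightedGraph where
  IsOpen U := ∀ G ∈ U, ∃ r : ℕ, ∃ ε : ℝ, 0 < ε ∧ ∀ G', LocallyClose r ε G G' → G' ∈ U
  isOpen_univ := fun _ _ => ⟨0, 1, one_pos, fun _ _ => Set.mem_univ _⟩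
  isOpen_inter := by
    intro U U' hU hU' G hG
    obtain ⟨r, ε, hε, h⟩ := hU G hG.1
    obtain ⟨r', ε', hε', h'⟩ := hU' G hG.2
    exact ⟨max r r', min ε ε', lt_min hε hε', fun G' hG' =>
      ⟨h G' (hG'.mono (le_max_left _ _) (min_le_left _ _)),
        h' G' (hG'.mono (le_max_right _ _) (min_le_right _ _))⟩⟩
  isOpen_sUnion := by
    intro S hS G hG
    obtain ⟨U, hU, hGU⟩ := hG
    obtain ⟨r, ε, hε, h⟩ := hS U hU G hGU
    exact ⟨r, ε, hε, fun G' hG' => ⟨U, hU, h G' hG'⟩⟩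

instance isomorphicSetoid : Setoid RootedWeightedGraph where
  r := Isomorphic
  iseqv :=
    { refl := fun _ => ⟨Equiv.refl _, rfl, fun _ _ => rfl⟩
      symm := by
        rintro G G' ⟨e, he, hw⟩
        refine ⟨e.symm, by rw [← he, Equiv.symm_apply_apply], fun u v => ?_⟩
        rw [← hw, Equiv.apply_symm_apply, Equiv.apply_symm_apply]
      trans := by
        rintro G G' G'' ⟨e, he, hw⟩ ⟨e', he', hw'⟩
        refine ⟨e.trans e', by simp [he, he'], fun u v => ?_⟩
        rw [Equiv.trans_apply, Equiv.trans_apply, hw', hw] }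

end RootedWeightedGraph

/-- The space of isomorphism classes of connected, locally finite, rooted weighted graphs, with the
(quotient of the) local topology and its Borel sets. -/
def RootedGraphClass : Type 1 := Quotient RootedWeightedGraph.isomorphicSetoid

instance : TopologicalSpace RootedGraphClass :=
  inferInstanceAs (TopologicalSpace (Quotient RootedWeightedGraph.isomorphicSetoid))

instance : MeasurableSpace RootedGraphClass := borel RootedGraphClass

instance : BorelSpace RootedGraphClass := ⟨rfl⟩

/-- The isomorphism class of a rooted weighted graph. -/
def RootedWeightedGraph.toClass (G : RootedWeightedGraph) : RootedGraphClass :=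
  Quotient.mk RootedWeightedGraph.isomorphicSetoid G

/-- Benjamini–Schramm convergence of the random rooted graphs `G n` (on the probability spaces
`(Ω n, μ n)`) to the random rooted graph `G'`: the laws of their isomorphism classes converge
weakly with respect to the local topology. -/
def BenjaminiSchrammConverges {Ω : ℕ → Type*} [∀ n, MeasurableSpace (Ω n)]
    {Ω' : Type*} [MeasurableSpace Ω']
    (G : ∀ n, Ω n → RootedWeightedGraph) (μ : ∀ n, Measure (Ω n)) [∀ n, IsProbabilityMeasure (μ n)]
    (G' : Ω' → RootedWeightedGraph) (μ' : Measure Ω') [IsProbabilityMeasure μ'] : Prop :=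
  TendstoInDistribution (fun n ω => (G n ω).toClass) atTop (fun ω => (G' ω).toClass) μ μ'

/-! ## Projection-valued measures and spectral measures -/

/-- A projection-valued measure on the Borel sets of `ℝ`: orthogonal projections, countably
additive in the strong operator topology. -/
structure ProjectionValuedMeasure (H : Type*) [NormedAddCommGroup H] [InnerProductSpace ℂ H]
    [CompleteSpace H] where
  proj : Set ℝ → H →L[ℂ] H
  isStarProjection : ∀ X, MeasurableSet X → IsStarProjection (proj X)
  univ : proj Set.univ = 1
  hasSum_iUnion : ∀ X : ℕ → Set ℝ, (∀ i, MeasurableSet (X i)) → Pairwise (Function.onFun Disjoint X) →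
    ∀ ψ : H, HasSum (fun i => proj (X i) ψ) (proj (⋃ i, X i) ψ)

namespace ProjectionValuedMeasure

variable {H : Type*} [NormedAddCommGroup H] [InnerProductSpace ℂ H] [CompleteSpace H]

theorem re_inner_nonneg (P : ProjectionValuedMeasure H) (ψ : H) {X : Set ℝ}
    (hX : MeasurableSet X) : 0 ≤ (⟪P.proj X ψ, ψ⟫_ℂ).re := by
  have h := (ContinuousLinearMap.nonneg_iff_isPositive _).1 (P.isStarProjection X hX).nonneg
  exact h.re_inner_nonneg_left ψ

theorem proj_empty (P : ProjectionValuedMeasure H) (ψ : H) : P.proj ∅ ψ = 0 := by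
  have h := P.hasSum_iUnion (fun _ => ∅) (fun _ => MeasurableSet.empty)
    (fun _ _ _ => disjoint_bot_left) ψ
  exact tendsto_nhds_unique tendsto_const_nhds h.summable.tendsto_atTop_zero

/-- The finite Borel measure `X ↦ ⟪P_X ψ, ψ⟫`. -/
noncomputable def measure (P : ProjectionValuedMeasure H) (ψ : H) : Measure ℝ :=
  Measure.ofMeasurable (fun X _ => ENNReal.ofReal (⟪P.proj X ψ, ψ⟫_ℂ).re)
    (by simp [P.proj_empty])
    (by
      intro X hX hd
      have h := P.hasSum_iUnion X hX hd ψ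
      have h2 : HasSum (fun i => (⟪P.proj (X i) ψ, ψ⟫_ℂ).re) (⟪P.proj (⋃ i, X i) ψ, ψ⟫_ℂ).re := by
        have h3 := h.mapL (Complex.reCLM.comp (((innerSL ℂ) ψ).restrictScalars ℝ))
        have h4 : ∀ φ : H, (⟪φ, ψ⟫_ℂ).re =
            Complex.reCLM.comp (((innerSL ℂ) ψ).restrictScalars ℝ) φ := by
          intro φ
          exact inner_re_symm (𝕜 := ℂ) φ ψ
        simp only [h4]
        exact h3
      rw [← h2.tsum_eq, ENNReal.ofReal_tsum_of_nonneg
        (fun i => P.re_inner_nonneg ψ (hX i)) h2.summable])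

/-- `P` is the projection-valued measure of the operator `A`, i.e. `A = ∫ x dP(x)`. -/
def Represents (P : ProjectionValuedMeasure H) (A : H →L[ℂ] H) : Prop :=
  ∀ ψ : H, Integrable (fun x : ℝ => x) (P.measure ψ) ∧
    ⟪A ψ, ψ⟫_ℂ = ((∫ x, x ∂(P.measure ψ) : ℝ) : ℂ)

end ProjectionValuedMeasure

/-- `A` is the (bounded) adjacency operator of the weighted graph `G` on `ℓ²(V)`, i.e.
`(A f)(v) = ∑ u, l(v,u) f(u)`; the sum is finite because `G` is locally finite. -/
def WeightedGraph.IsAdjacencyOperator {V : Type} (G : WeightedGraph V)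
    (A : lp (fun _ : V => ℂ) 2 →L[ℂ] lp (fun _ : V => ℂ) 2) : Prop :=
  ∀ (f : lp (fun _ : V => ℂ) 2) (v : V), A f v = ∑ᶠ u, (G.weight v u : ℂ) * f u

open Classical in
/-- `μ` is the spectral measure `X ↦ ⟪P_X χ_o, χ_o⟫` of the adjacency operator of `G` with respect
to the root `o`, where `P` is the projection-valued measure of the adjacency operator and `χ_o` the
indicator function of the root. -/
def RootedWeightedGraph.IsSpectralMeasure (G : RootedWeightedGraph) (μ : Measure ℝ) : Prop :=
  ∃ A : lp (fun _ : G.V => ℂ) 2 →L[ℂ] lp (fun _ : G.V => ℂ) 2, G.toGraph.IsAdjacencyOperator A ∧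
    ∃ P : ProjectionValuedMeasure (lp (fun _ : G.V => ℂ) 2), P.Represents A ∧
      μ = P.measure (lp.single 2 G.root (1 : ℂ))

/-- `ν` is the expected spectral measure of the random rooted graph `G`, i.e. the expectation of
the spectral measure of `G ω` with respect to its root. -/
def IsExpectedSpectralMeasure {Ω : Type*} [MeasurableSpace Ω] (G : Ω → RootedWeightedGraph)
    (P : Measure Ω) (ν : Measure ℝ) : Prop :=
  ∃ μ : Ω → Measure ℝ, AEMeasurable μ P ∧ (∀ᵐ ω ∂P, (G ω).IsSpectralMeasure (μ ω)) ∧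
    ∀ X : Set ℝ, MeasurableSet X → ν X = ∫⁻ ω, μ ω X ∂P

/-! ## The β-Hermite ensemble -/

/-- The symmetric tridiagonal matrix of size `n + 1` with diagonal `a` and off-diagonal `b`. -/
def tridiag {n : ℕ} (a : Fin (n + 1) → ℝ) (b : Fin n → ℝ) : Matrix (Fin (n + 1)) (Fin (n + 1)) ℝ :=
  Matrix.of fun i j =>
    if i = j then a i
    else if h : i.val + 1 = j.val then b ⟨i.val, by omega⟩
    else if h : j.val + 1 = i.val then b ⟨j.val, by omega⟩
    else 0

theorem tridiag_isSymm {n : ℕ} (a : Fin (n + 1) → ℝ) (b : Fin n → ℝ) : (tridiag a b).IsSymm := by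
  ext i j
  simp only [tridiag, Matrix.transpose_apply, Matrix.of_apply]
  split_ifs <;> first | rfl | omega | simp_all

/-- The weighted graph whose adjacency matrix is the symmetric matrix `M`. -/
def graphOfMatrix {n : ℕ} (M : Matrix (Fin n) (Fin n) ℝ) (hM : M.IsSymm) :
    WeightedGraph (Fin n) where
  weight i j := M i j
  symm i j := hM.apply j i
  locallyFinite _ := Set.toFinite _

/-- The law `χ_k` of the square root of a chi-squared variable with `k > 0` degrees of freedom. -/
noncomputable def chiLaw (k : ℝ) : Measure ℝ := (gammaMeasure (k / 2) (1 / 2)).map Real.sqrt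

/-- The joint law of the entries `(a_1, …, a_N)` and `(b_1, …, b_{N-1})` of the β-Hermite matrix of
size `N = n + 1`: independent, `a_j ∼ N(0,2)/√N` (variance `2`) and `b_j ∼ χ_{βj}/√N`. -/
noncomputable def hermiteEntriesLaw (β : ℝ) (n : ℕ) :
    Measure ((Fin (n + 1) → ℝ) × (Fin n → ℝ)) :=
  (Measure.pi fun _ : Fin (n + 1) => (gaussianReal 0 2).map fun x => x / √((n : ℝ) + 1)).prod
    (Measure.pi fun j : Fin n => (chiLaw (β * ((j : ℝ) + 1))).map fun x => x / √((n : ℝ) + 1))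

/-- The weighted graph of the tridiagonal matrix with diagonal `x.1` and off-diagonal `x.2`, rooted
at `o`. -/
def tridiagRootedGraph {n : ℕ} (x : (Fin (n + 1) → ℝ) × (Fin n → ℝ)) (o : Fin (n + 1)) :
    RootedWeightedGraph where
  V := Fin (n + 1)
  toGraph := graphOfMatrix (tridiag x.1 x.2) (tridiag_isSymm x.1 x.2)
  root := o

/-- The graph on `ℤ` in which consecutive integers are joined by edges of constant weight `c`,
without loops, rooted at `0`. -/
def integerLine (c : ℝ) : RootedWeightedGraph where
  V := ℤ
  toGraph :=
    { weight := fun u v => if u + 1 = v ∨ v + 1 = u then c else 0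
      symm := fun u v => by simp only [or_comm]
      locallyFinite := fun v => (Set.toFinite {v + 1, v - 1}).subset (by
        intro u hu
        simp only [Set.mem_ofPred_eq, ne_eq, ite_eq_right_iff, Classical.not_imp] at hu
        simp only [Set.mem_insert_iff, Set.mem_singleton_iff]
        omega) }
  root := 0

/-- The semicircle law `√(4β - x²) / (2πβ) dx` on `[-2√β, 2√β]`. -/
noncomputable def semicircleLaw (β : ℝ) : Measure ℝ :=
  volume.withDensity fun x => ENNReal.ofReal
    ((Set.Icc (-(2 * √β)) (2 * √β)).indicator
      (fun x => √(4 * β - x ^ 2) / (2 * Real.pi * β)) x)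

/-! ## Local closeness and continuity -/

namespace RootedWeightedGraph

/-! Part (i) is a law of large numbers seen from a typical vertex. If the root sits at position
`uN`, the squared edge weights near it are `χ²` variables with about `βuN` degrees of freedom,
divided by `N`, hence close to `βu`, while the loops have size of order `N^(-1/2)`. So the ball
looks like that of the integer line of weight `√(βu)`, and a uniform root makes `u` uniform.

For almost sure convergence under any joint law of the sizes, the error must be summable in `N`.
`tridiagDefect` measures it by fourth powers, with expectation `O(N⁻²)`
(`integral_tridiagDefect_le`); second powers would only give `O(N⁻¹)`. The sum of all defects then
has finite expectation, so the defects tend to `0` almost surely (`ae_tendsto_tridiagDefect`). The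
rest is deterministic: a Markov count bounds the proportion of roots with a bad ball
(`card_not_locallyClose_le`), and averages of a bounded continuous function are compared with
Riemann sums in `u` (`tendsto_average_tridiagRootedGraph`). Integrating over the matrices gives
convergence for the joint randomness. Edge weight `0`, where the graph structure jumps, costs only
null sets or few roots.

For part (ii), Fourier series turn `A_u` into multiplication by `2√(βu) cos θ` on the circle and
`χ_0` into the constant `1`, so the spectral measure is the law of `2√(βu) cos θ` with `θ` uniform.
For uniform `u`, `2√(βu)` is the radius of a uniform point of the disc of radius `2√β`. The expected
spectral measure is thus the law of one coordinate of that point, and chord lengths give the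
semicircle (`lintegral_polar_disc`). -/

theorem LocallyClose.symm {r : ℕ} {ε : ℝ} {G G' : RootedWeightedGraph}
    (h : LocallyClose r ε G G') : LocallyClose r ε G' G := by
  obtain ⟨e, he, hw⟩ := h
  refine ⟨e.symm, by rw [← he, Equiv.symm_apply_apply], fun u v => ?_⟩
  have := hw (e.symm u) (e.symm v)
  simp only [Equiv.apply_symm_apply] at this
  exact ⟨this.1.symm, by rw [abs_sub_comm]; exact this.2⟩

/-- An injective map of vertices which preserves roots, and locally preserves edges, nearly
preserves weights, and lifts neighbours, induces a local isomorphism. -/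
theorem locallyClose_of_injective {G G' : RootedWeightedGraph} {r : ℕ} {ε : ℝ} (φ : G.V → G'.V)
    (hφ : Function.Injective φ) (hroot : φ G.root = G'.root)
    (hadj : ∀ u ∈ G.ball r, ∀ v ∈ G.ball r,
      (G.toGraph.graph.Adj u v ↔ G'.toGraph.graph.Adj (φ u) (φ v)))
    (hw : ∀ u ∈ G.ball r, ∀ v ∈ G.ball r,
      |G.toGraph.weight u v - G'.toGraph.weight (φ u) (φ v)| < ε)
    (hlift : ∀ s < r, ∀ u ∈ G.ball s, ∀ w, G'.toGraph.graph.Adj (φ u) w →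
      ∃ v, G.toGraph.graph.Adj u v ∧ φ v = w) :
    LocallyClose r ε G G' := by
  -- Induction on the radius: preservation of edges gives one inclusion, lifting of neighbours the
  -- other.
  have key : ∀ s ≤ r, φ '' G.ball s = G'.ball s := by
    intro s
    induction s with
    | zero =>
      intro _
      ext w
      simp only [Set.mem_image, mem_ball_zero, exists_eq_left, hroot, eq_comm]
    | succ s ih =>
      intro hs
      have ih := ih (by omega)
      ext w
      rw [mem_ball_succ, ← ih]
      constructor
      · rintro ⟨v, hv, rfl⟩
        rcases (mem_ball_succ G s v).1 hv with h | ⟨u, hu, huv⟩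
        · exact Or.inl ⟨v, h, rfl⟩
        · exact Or.inr ⟨φ u, ⟨u, hu, rfl⟩,
            (hadj u (G.ball_mono (by omega) hu) v (G.ball_mono hs hv)).1 huv⟩
      · rintro (⟨v, hv, rfl⟩ | ⟨_, ⟨u, hu, rfl⟩, huw⟩)
        · exact ⟨v, G.ball_mono (by omega) hv, rfl⟩
        · obtain ⟨v, huv, rfl⟩ := hlift s (by omega) u hu w huw
          exact ⟨v, (mem_ball_succ G s v).2 (Or.inr ⟨u, hu, huv⟩), rfl⟩
  refine ⟨(Equiv.Set.image φ (G.ball r) hφ).trans (Equiv.setCongr (key r le_rfl)), ?_, ?_⟩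
  · apply Subtype.ext
    simp [hroot]
  · intro u v
    exact ⟨hadj u u.2 v v.2, hw u u.2 v v.2⟩

theorem continuous_toClass : Continuous toClass := continuous_quotient_mk'

/-- A set of classes is open exactly when its preimage is, and the local topology is defined by such
neighbourhoods. No finer property of the space, such as metrisability, is needed. -/
theorem exists_locallyClose_of_isOpen {U : Set RootedGraphClass} (hU : IsOpen U)
    {G : RootedWeightedGraph} (hG : G.toClass ∈ U) :
    ∃ r : ℕ, ∃ ε : ℝ, 0 < ε ∧ ∀ G', LocallyClose r ε G G' → G'.toClass ∈ U :=
  (hU.preimage continuous_toClass : IsOpen (toClass ⁻¹' U)) G hG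

theorem continuousOn_toClass {X : Type*} [TopologicalSpace X] {Φ : X → RootedWeightedGraph}
    {S : Set X}
    (h : ∀ x ∈ S, ∀ r : ℕ, ∀ ε > 0, ∀ᶠ y in 𝓝[S] x, LocallyClose r ε (Φ x) (Φ y)) :
    ContinuousOn (fun x => (Φ x).toClass) S := by
  intro x hx
  rw [ContinuousWithinAt, tendsto_nhds]
  intro U hU hxU
  obtain ⟨r, ε, hε, hr⟩ := exists_locallyClose_of_isOpen hU hxU
  filter_upwards [h x hx r ε hε] with y hy using hr _ hy

theorem exists_locallyClose_abs_lt {f : RootedGraphClass → ℝ} (hf : Continuous f)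
    (G : RootedWeightedGraph) {δ : ℝ} (hδ : 0 < δ) :
    ∃ r : ℕ, ∃ ε : ℝ, 0 < ε ∧ ∀ G', LocallyClose r ε G G' →
      |f G'.toClass - f G.toClass| < δ := by
  obtain ⟨r, ε, hε, h⟩ := exists_locallyClose_of_isOpen (G := G) (Metric.isOpen_ball.preimage hf :
    IsOpen (f ⁻¹' Metric.ball (f G.toClass) δ)) (Metric.mem_ball_self hδ)
  exact ⟨r, ε, hε, fun G' hG' => by simpa [Real.dist_eq] using h G' hG'⟩

end RootedWeightedGraph

open RootedWeightedGraph

/-! ## Paths -/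

theorem tridiag_self {n : ℕ} (a : Fin (n + 1) → ℝ) (b : Fin n → ℝ) (i : Fin (n + 1)) :
    tridiag a b i i = a i := by simp [tridiag]

theorem tridiag_succ {n : ℕ} (a : Fin (n + 1) → ℝ) (b : Fin n → ℝ) {i j : Fin (n + 1)}
    (h : i.val + 1 = j.val) : tridiag a b i j = b ⟨i.val, by omega⟩ := by
  have : i ≠ j := by rintro rfl; omega
  simp [tridiag, this, h]

theorem tridiag_pred {n : ℕ} (a : Fin (n + 1) → ℝ) (b : Fin n → ℝ) {i j : Fin (n + 1)}
    (h : j.val + 1 = i.val) : tridiag a b i j = b ⟨j.val, by omega⟩ := by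
  rw [← tridiag_succ a b h, (tridiag_isSymm a b).apply]

theorem tridiag_of_not_adj {n : ℕ} (a : Fin (n + 1) → ℝ) (b : Fin n → ℝ) {i j : Fin (n + 1)}
    (h : i ≠ j) (h₁ : i.val + 1 ≠ j.val) (h₂ : j.val + 1 ≠ i.val) : tridiag a b i j = 0 := by
  simp [tridiag, h, h₁, h₂]

theorem tridiagRootedGraph_adj {n : ℕ} {x : (Fin (n + 1) → ℝ) × (Fin n → ℝ)}
    (hx : ∀ j, x.2 j ≠ 0) (o i j : Fin (n + 1)) :
    (tridiagRootedGraph x o).toGraph.graph.Adj i j ↔ i.val + 1 = j.val ∨ j.val + 1 = i.val := by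
  change (i ≠ j ∧ tridiag x.1 x.2 i j ≠ 0) ↔ _
  constructor
  · rintro ⟨hij, h⟩
    by_contra! hc
    exact h (tridiag_of_not_adj _ _ hij hc.1 hc.2)
  · rintro (h | h)
    · exact ⟨by rintro rfl; omega, by rw [tridiag_succ _ _ h]; exact hx _⟩
    · exact ⟨by rintro rfl; omega, by rw [tridiag_pred _ _ h]; exact hx _⟩

theorem integerLine_adj {c : ℝ} (hc : c ≠ 0) (u v : ℤ) :
    (integerLine c).toGraph.graph.Adj u v ↔ u + 1 = v ∨ v + 1 = u := by
  change (u ≠ v ∧ (if u + 1 = v ∨ v + 1 = u then c else 0) ≠ 0) ↔ _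
  constructor
  · rintro ⟨-, h⟩
    by_contra hc
    exact h (if_neg hc)
  · intro h
    exact ⟨by omega, by rw [if_pos h]; exact hc⟩

theorem tridiagRootedGraph_locallyClose {n : ℕ} {x y : (Fin (n + 1) → ℝ) × (Fin n → ℝ)}
    (hx : ∀ j, x.2 j ≠ 0) (hy : ∀ j, y.2 j ≠ 0) (o : Fin (n + 1)) (r : ℕ) {ε : ℝ}
    (hxy : dist x y < ε) :
    LocallyClose r ε (tridiagRootedGraph x o) (tridiagRootedGraph y o) := by
  have hadj : ∀ i j, (tridiagRootedGraph x o).toGraph.graph.Adj i j ↔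
      (tridiagRootedGraph y o).toGraph.graph.Adj i j := fun i j =>
    (tridiagRootedGraph_adj hx o i j).trans (tridiagRootedGraph_adj hy o i j).symm
  refine locallyClose_of_injective id Function.injective_id rfl (fun i _ j _ => hadj i j) ?_
    (fun s _ u _ w h => ⟨w, (hadj u w).2 h, rfl⟩)
  intro (i : Fin (n + 1)) _ (j : Fin (n + 1)) _
  change |tridiag x.1 x.2 i j - tridiag y.1 y.2 i j| < ε
  have h₂ : ∀ k, |x.2 k - y.2 k| < ε := fun k =>
    ((dist_le_pi_dist x.2 y.2 k).trans (le_max_right _ _)).trans_lt hxy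
  have hε : 0 < ε := dist_nonneg.trans_lt hxy
  unfold tridiag
  simp only [Matrix.of_apply]
  split_ifs
  · exact ((dist_le_pi_dist x.1 y.1 i).trans (le_max_left _ _)).trans_lt hxy
  · exact h₂ _
  · exact h₂ _
  · simpa using hε

theorem integerLine_locallyClose {c d : ℝ} (hc : c ≠ 0) (hd : d ≠ 0) (r : ℕ) {ε : ℝ}
    (hcd : |c - d| < ε) : LocallyClose r ε (integerLine c) (integerLine d) := by
  have hadj : ∀ i j, (integerLine c).toGraph.graph.Adj i j ↔
      (integerLine d).toGraph.graph.Adj i j := fun i j =>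
    (integerLine_adj hc i j).trans (integerLine_adj hd i j).symm
  refine locallyClose_of_injective id Function.injective_id rfl (fun i _ j _ => hadj i j) ?_
    (fun s _ u _ w h => ⟨w, (hadj u w).2 h, rfl⟩)
  intro (i : ℤ) _ (j : ℤ) _
  change |(if i + 1 = j ∨ j + 1 = i then c else 0) - (if i + 1 = j ∨ j + 1 = i then d else 0)| < ε
  split_ifs
  · exact hcd
  · simpa using (abs_nonneg _).trans_lt hcd

/-- The weight `0` is excluded because there the edges vanish, the balls collapse to the root and
continuity fails. -/
theorem continuousOn_integerLine :
    ContinuousOn (fun c => (integerLine c).toClass) {c : ℝ | c ≠ 0} := by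
  refine continuousOn_toClass fun x hx r ε hε => ?_
  filter_upwards [self_mem_nhdsWithin, mem_nhdsWithin_of_mem_nhds (Metric.ball_mem_nhds x hε)]
    with y hy hxy
  exact integerLine_locallyClose hx hy r (by rwa [← Real.dist_eq, dist_comm])

theorem le_of_mem_ball_tridiagRootedGraph {n : ℕ} {x : (Fin (n + 1) → ℝ) × (Fin n → ℝ)}
    (hx : ∀ j, x.2 j ≠ 0) (o : Fin (n + 1)) (r : ℕ) (i : Fin (n + 1))
    (hi : i ∈ (tridiagRootedGraph x o).ball r) : i.val ≤ o.val + r ∧ o.val ≤ i.val + r := by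
  induction r generalizing i with
  | zero =>
    have : i = o := ((tridiagRootedGraph x o).mem_ball_zero i).1 hi
    subst this
    omega
  | succ r ih =>
    rcases ((tridiagRootedGraph x o).mem_ball_succ r i).1 hi with h | ⟨u, hu, hui⟩
    · have := ih i h
      omega
    · have := ih u hu
      have := (tridiagRootedGraph_adj hx o u i).1 hui
      omega

/-- Far from its ends, a path with small loops and with edge weights close to `c` looks like the
integer line with edge weights `c`. -/
theorem integerLine_locallyClose_tridiagRootedGraph {n : ℕ}
    {x : (Fin (n + 1) → ℝ) × (Fin n → ℝ)} (hx : ∀ j, x.2 j ≠ 0) {c : ℝ} (hc : c ≠ 0)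
    {o : Fin (n + 1)} {r : ℕ} (h₁ : r ≤ o.val) (h₂ : o.val + r ≤ n) {ε : ℝ} (hε : 0 < ε)
    (ha : ∀ j : Fin (n + 1), j.val ≤ o.val + r → o.val ≤ j.val + r → |x.1 j| < ε)
    (hb : ∀ j : Fin n, j.val ≤ o.val + r → o.val ≤ j.val + r → |x.2 j - c| < ε) :
    LocallyClose r ε (integerLine c) (tridiagRootedGraph x o) := by
  -- The translation `i ↦ i - o` is defined on the whole finite path, whereas its inverse is not
  -- defined on all of `ℤ`.
  apply LocallyClose.symm
  refine locallyClose_of_injective (G := tridiagRootedGraph x o) (G' := integerLine c)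
    (fun i : Fin (n + 1) => (i.val : ℤ) - (o.val : ℤ)) ?_ ?_ ?_ ?_ ?_
  · intro (i : Fin (n + 1)) (j : Fin (n + 1)) hij
    change (i.val : ℤ) - o.val = j.val - o.val at hij
    exact Fin.ext (by omega)
  · exact sub_self (o.val : ℤ)
  · intro (i : Fin (n + 1)) _ (j : Fin (n + 1)) _
    refine (tridiagRootedGraph_adj hx o i j).trans
      (Iff.trans ?_ (integerLine_adj hc ((i.val : ℤ) - o.val) ((j.val : ℤ) - o.val)).symm)
    omega
  · intro (i : Fin (n + 1)) hi (j : Fin (n + 1)) hj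
    have hi' := le_of_mem_ball_tridiagRootedGraph hx o r i hi
    have hj' := le_of_mem_ball_tridiagRootedGraph hx o r j hj
    change |tridiag x.1 x.2 i j - (if (i.val : ℤ) - o.val + 1 = j.val - o.val ∨
      (j.val : ℤ) - o.val + 1 = i.val - o.val then c else 0)| < ε
    by_cases hij : i = j
    · subst hij
      rw [tridiag_self, if_neg (by omega), sub_zero]
      exact ha i hi'.1 hi'.2
    by_cases h : i.val + 1 = j.val
    · rw [tridiag_succ _ _ h, if_pos (by omega)]
      exact hb _ hi'.1 hi'.2
    by_cases h' : j.val + 1 = i.val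
    · rw [tridiag_pred _ _ h', if_pos (by omega)]
      exact hb _ hj'.1 hj'.2
    · rw [tridiag_of_not_adj _ _ hij h h', if_neg (by omega)]
      simpa using hε
  · intro s hs (u : Fin (n + 1)) hu (w : ℤ) hw
    have hu' := le_of_mem_ball_tridiagRootedGraph hx o s u hu
    have hw := (integerLine_adj hc ((u.val : ℤ) - o.val) w).1 hw
    -- Since `s < r`, a neighbour of a vertex within `s` of the root is within `r` of it, and `h₁`,
    -- `h₂` keep this range inside the path.
    have hw' : 0 ≤ w + o.val ∧ w + o.val ≤ n := by omega
    refine ⟨(⟨(w + o.val).toNat, by omega⟩ : Fin (n + 1)),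
      (tridiagRootedGraph_adj hx o u _).2 ?_, ?_⟩
    · simp only
      omega
    · change (((w + o.val).toNat : ℕ) : ℤ) - o.val = w
      omega

/-! ## Deterministic convergence -/

theorem RootedWeightedGraph.LocallyClose.trans {r : ℕ} {ε δ : ℝ} {G G' G'' : RootedWeightedGraph}
    (h : LocallyClose r ε G G') (h' : LocallyClose r δ G' G'') :
    LocallyClose r (ε + δ) G G'' := by
  obtain ⟨e, he, hw⟩ := h
  obtain ⟨e', he', hw'⟩ := h'
  refine ⟨e.trans e', by simp [he, he'], fun u v => ⟨(hw u v).1.trans (hw' _ _).1, ?_⟩⟩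
  exact (abs_sub_le _ _ _).trans_lt (add_lt_add (hw u v).2 (hw' (e u) (e v)).2)

/-- A continuous function is uniformly continuous near the integer lines with edge weights in a
compact interval. -/
theorem exists_locallyClose_integerLine_abs_lt {f : RootedGraphClass → ℝ} (hf : Continuous f)
    {a : ℝ} (ha : 0 < a) (b : ℝ) {δ : ℝ} (hδ : 0 < δ) :
    ∃ r : ℕ, ∃ ε : ℝ, 0 < ε ∧ ∀ c ∈ Set.Icc a b, ∀ G, LocallyClose r ε (integerLine c) G →
      |f G.toClass - f (integerLine c).toClass| < δ := by
  -- The property passes to subsets and finite unions, so by compactness it suffices to check it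
  -- near each `c`.
  refine (isCompact_Icc : IsCompact (Set.Icc a b)).induction_on
    (p := fun s => ∃ r : ℕ, ∃ ε : ℝ, 0 < ε ∧ ∀ c ∈ s, ∀ G, LocallyClose r ε (integerLine c) G →
      |f G.toClass - f (integerLine c).toClass| < δ) ?_ ?_ ?_ ?_
  · exact ⟨0, 1, one_pos, fun c hc => hc.elim⟩
  · rintro s t hst ⟨r, ε, hε, h⟩
    exact ⟨r, ε, hε, fun c hc => h c (hst hc)⟩
  · rintro s t ⟨r, ε, hε, h⟩ ⟨r', ε', hε', h'⟩
    refine ⟨max r r', min ε ε', lt_min hε hε', ?_⟩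
    rintro c (hc | hc) G hG
    · exact h c hc G (hG.mono (le_max_left _ _) (min_le_left _ _))
    · exact h' c hc G (hG.mono (le_max_right _ _) (min_le_right _ _))
  · intro c hc
    have hc0 : 0 < c := ha.trans_le hc.1
    -- If `d` is within `ε / 2` of `c` and `G` is `ε / 2`-close to the line of weight `d`, then both
    -- are `ε`-close to the line of weight `c`, and `f` varies by less than `δ / 2` twice.
    obtain ⟨r, ε, hε, h⟩ := exists_locallyClose_abs_lt hf (integerLine c) (half_pos hδ)
    refine ⟨Metric.ball c (ε / 2) ∩ Set.Ioi 0,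
      mem_nhdsWithin_of_mem_nhds (inter_mem (Metric.ball_mem_nhds c (half_pos hε))
        (Ioi_mem_nhds hc0)), r, ε / 2, half_pos hε, ?_⟩
    rintro d ⟨hd, hd0⟩ G hG
    have hd : |c - d| < ε / 2 := by rwa [← Real.dist_eq, dist_comm]
    have h₁ := integerLine_locallyClose hc0.ne' (ne_of_gt hd0) r hd
    have h₂ := h _ (h₁.mono le_rfl (by linarith))
    have h₃ := h G (by simpa using h₁.trans hG)
    rw [abs_lt] at h₂ h₃ ⊢
    constructor <;> linarith [h₂.1, h₂.2, h₃.1, h₃.2]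

/-! ### Counting the roots with an atypical neighbourhood -/

/-- The average deviation (in fourth mean) of the loops from `0` and of the squares of the edge
weights from their limits. -/
noncomputable def tridiagDefect (β : ℝ) {n : ℕ} (x : (Fin (n + 1) → ℝ) × (Fin n → ℝ)) : ℝ :=
  (∑ j, x.1 j ^ 4 + ∑ j : Fin n, (x.2 j ^ 2 - β * (j + 1) / (n + 1)) ^ 4) / (n + 1)

theorem card_filter_fin_le {n : ℕ} (p : Fin n → Prop) [DecidablePred p] (a k : ℕ)
    (h : ∀ o, p o → a ≤ o.val ∧ o.val < a + k) :
    (Finset.univ.filter p).card ≤ k := by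
  calc (Finset.univ.filter p).card ≤ (Finset.Ico a (a + k)).card :=
        Finset.card_le_card_of_injOn Fin.val (fun o ho => by
          simpa using h o (by simpa using ho)) (Fin.val_injective.injOn)
    _ = k := by simp

/-- Markov's inequality for the fourth power and counting measure. -/
theorem card_mul_le_sum {ι : Type*} [Fintype ι] (g : ι → ℝ) {ε : ℝ} (hε : 0 < ε) :
    ((Finset.univ.filter fun j => ε ≤ |g j|).card : ℝ) ≤ 1 / ε ^ 4 * ∑ j, g j ^ 4 := by
  rw [one_div, inv_mul_eq_div, le_div_iff₀ (by positivity)]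
  calc ((Finset.univ.filter fun j => ε ≤ |g j|).card : ℝ) * ε ^ 4
      = ∑ j ∈ Finset.univ.filter fun j => ε ≤ |g j|, ε ^ 4 := by simp
    _ ≤ ∑ j ∈ Finset.univ.filter fun j => ε ≤ |g j|, g j ^ 4 := by
        refine Finset.sum_le_sum fun j hj => ?_
        rw [Finset.mem_filter] at hj
        rw [← Even.pow_abs (by decide : Even 4) (g j)]
        exact pow_le_pow_left₀ hε.le hj.2 4
    _ ≤ ∑ j, g j ^ 4 :=
        Finset.sum_le_sum_of_subset_of_nonneg (Finset.filter_subset _ _)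
          fun _ _ _ => by positivity

open Classical in
/-- All but few vertices of a path of small defect have a neighbourhood close to the integer line. -/
theorem card_not_locallyClose_le {β : ℝ} (hβ : 0 < β) {n : ℕ}
    {x : (Fin (n + 1) → ℝ) × (Fin n → ℝ)} (hx : ∀ j, 0 < x.2 j) {r : ℕ} {ε η : ℝ} (hε : 0 < ε)
    (hη : 0 < η) (hn : β * (r + 1) / (n + 1) < ε ^ 2 / 2) :
    ((Finset.univ.filter fun o : Fin (n + 1) => ¬ (η ≤ (o : ℝ) / (n + 1) ∧
        LocallyClose r ε (integerLine √(β * ((o : ℝ) / (n + 1))))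
          (tridiagRootedGraph x o))).card : ℝ) / (n + 1) ≤
      η + (2 * r + 1) / (n + 1) +
        (2 * r + 1) * (1 / ε ^ 4 + 1 / (ε ^ 2 / 2) ^ 4) * tridiagDefect β x := by
  have hN : (0 : ℝ) < n + 1 := by positivity
  set A : Finset (Fin (n + 1)) := Finset.univ.filter fun j => ε ≤ |x.1 j|
  set B : Finset (Fin n) :=
    Finset.univ.filter fun j => ε ^ 2 / 2 ≤ |x.2 j ^ 2 - β * (j + 1) / (n + 1)|
  -- An atypical loop (`A`) or edge (`B`) spoils only the at most `2r + 1` roots within distance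
  -- `r`. The other bad roots lie near an end (`S₁`, `S₂`) or have position below `η` (`S₃`).
  set near : ℕ → Finset (Fin (n + 1)) := fun j =>
    Finset.univ.filter fun o => j ≤ o.val + r ∧ o.val ≤ j + r
  set S₁ : Finset (Fin (n + 1)) := Finset.univ.filter fun o => o.val < r
  set S₂ : Finset (Fin (n + 1)) := Finset.univ.filter fun o => n < o.val + r
  set S₃ : Finset (Fin (n + 1)) := Finset.univ.filter fun o => (o : ℝ) / (n + 1) < η
  have hnear : ∀ j, (near j).card ≤ 2 * r + 1 := fun j =>
    card_filter_fin_le _ (j - r) _ fun o ho => by omega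
  have hA : (A.card : ℝ) ≤ 1 / ε ^ 4 * ∑ j, x.1 j ^ 4 := card_mul_le_sum x.1 hε
  have hB : (B.card : ℝ) ≤
      1 / (ε ^ 2 / 2) ^ 4 * ∑ j : Fin n, (x.2 j ^ 2 - β * (j + 1) / (n + 1)) ^ 4 :=
    card_mul_le_sum (fun j : Fin n => x.2 j ^ 2 - β * (j + 1) / (n + 1)) (by positivity)
  have hS₁ : S₁.card ≤ r := card_filter_fin_le _ 0 _ fun o ho => by omega
  have hS₂ : S₂.card ≤ r := card_filter_fin_le _ (n + 1 - r) _ fun o ho => by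
    have := o.isLt
    omega
  -- The `1` lost to the ceiling joins the `2r` roots near the ends to make the `2r + 1` of the
  -- statement.
  have hS₃ : (S₃.card : ℝ) ≤ η * (n + 1) + 1 := by
    have : S₃.card ≤ ⌈η * (n + 1)⌉₊ := card_filter_fin_le _ 0 _ fun o ho => by
      rw [div_lt_iff₀ hN] at ho
      exact ⟨Nat.zero_le _, by simpa using Nat.lt_ceil.2 ho⟩
    exact (Nat.cast_le.2 this).trans (Nat.ceil_lt_add_one (by positivity)).le
  have hsub : (Finset.univ.filter fun o : Fin (n + 1) => ¬ (η ≤ (o : ℝ) / (n + 1) ∧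
        LocallyClose r ε (integerLine √(β * ((o : ℝ) / (n + 1)))) (tridiagRootedGraph x o))) ⊆
      A.biUnion (fun j => near j) ∪ B.biUnion (fun j => near j) ∪ S₁ ∪ S₂ ∪ S₃ := by
    intro o ho
    by_contra hc
    simp only [Finset.mem_union, Finset.mem_biUnion, not_or, not_exists, not_and, A, B, near, S₁,
      S₂, S₃, Finset.mem_filter, Finset.mem_univ, true_and] at hc
    obtain ⟨⟨⟨⟨hcA, hcB⟩, h₁⟩, h₂⟩, h₃⟩ := hc
    rw [not_lt] at h₁ h₂ h₃
    rw [Finset.mem_filter] at ho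
    refine ho.2 ⟨h₃, ?_⟩
    have hpos : 0 < β * ((o : ℝ) / (n + 1)) := mul_pos hβ (hη.trans_le h₃)
    refine integerLine_locallyClose_tridiagRootedGraph (fun j => (hx j).ne')
      (Real.sqrt_pos.2 hpos).ne' h₁ h₂ hε ?_ ?_
    · intro j hj hj'
      by_contra! h
      exact hcA j h hj hj'
    · intro j hj hj'
      have h : |x.2 j ^ 2 - β * (j + 1) / (n + 1)| < ε ^ 2 / 2 := by
        by_contra! h
        exact hcB j h hj hj'
      -- Edge `j` has parameter `j + 1`, so its distance from `o` is at most `r + 1`, the factor in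
      -- `hn`.
      have hjo : |β * ((j : ℝ) + 1) / (n + 1) - β * ((o : ℝ) / (n + 1))| < ε ^ 2 / 2 := by
        refine lt_of_le_of_lt ?_ hn
        rw [show β * ((j : ℝ) + 1) / (n + 1) - β * ((o : ℝ) / (n + 1)) =
          β * (j + 1 - o) / (n + 1) by ring, abs_div, abs_mul, abs_of_pos hβ, abs_of_pos hN]
        have h₄ : (j : ℝ) ≤ o + r := by exact_mod_cast hj
        have h₅ : (o : ℝ) ≤ j + r := by exact_mod_cast hj'
        gcongr
        rw [abs_le]
        constructor <;> linarith
      have hs := Real.sq_sqrt hpos.le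
      have hsp := Real.sqrt_nonneg (β * ((o : ℝ) / (n + 1)))
      set s := √(β * ((o : ℝ) / (n + 1)))
      -- For nonnegative numbers `|b - s|² ≤ |b - s| (b + s) = |b² - s²|`. Hence closeness `ε²` of
      -- the squares suffices, split into a random and a deterministic half of `ε² / 2`.
      refine lt_of_pow_lt_pow_left₀ 2 hε.le ?_
      calc |x.2 j - s| ^ 2 = |x.2 j - s| * |x.2 j - s| := sq _
        _ ≤ |x.2 j - s| * (x.2 j + s) := by
            gcongr
            rw [abs_le]
            constructor <;> linarith [hx j]
        _ = |x.2 j ^ 2 - s ^ 2| := by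
            rw [sq_sub_sq, abs_mul, abs_of_pos (by linarith [hx j] : 0 < x.2 j + s), mul_comm]
        _ ≤ |x.2 j ^ 2 - β * (j + 1) / (n + 1)| +
              |β * ((j : ℝ) + 1) / (n + 1) - β * ((o : ℝ) / (n + 1))| := by
            rw [hs]
            exact abs_sub_le _ _ _
        _ < ε ^ 2 := by linarith
  have hbA : (A.biUnion (fun j => near j)).card ≤ A.card * (2 * r + 1) :=
    Finset.card_biUnion_le_card_mul _ _ _ fun j _ => hnear j
  have hbB : (B.biUnion (fun j => near j)).card ≤ B.card * (2 * r + 1) :=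
    Finset.card_biUnion_le_card_mul _ _ _ fun j _ => hnear j
  have hcard := Finset.card_le_card hsub
  have hcard' : (Finset.univ.filter fun o : Fin (n + 1) => ¬ (η ≤ (o : ℝ) / (n + 1) ∧
        LocallyClose r ε (integerLine √(β * ((o : ℝ) / (n + 1))))
          (tridiagRootedGraph x o))).card ≤
      A.card * (2 * r + 1) + B.card * (2 * r + 1) + r + r + S₃.card := by
    refine hcard.trans ((Finset.card_union_le _ _).trans ?_)
    gcongr
    refine (Finset.card_union_le _ _).trans ?_
    gcongr
    refine (Finset.card_union_le _ _).trans ?_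
    gcongr
    refine (Finset.card_union_le _ _).trans ?_
    gcongr
  have hcard'' : ((Finset.univ.filter fun o : Fin (n + 1) => ¬ (η ≤ (o : ℝ) / (n + 1) ∧
        LocallyClose r ε (integerLine √(β * ((o : ℝ) / (n + 1))))
          (tridiagRootedGraph x o))).card : ℝ) ≤
      A.card * (2 * r + 1) + B.card * (2 * r + 1) + r + r + S₃.card := by exact_mod_cast hcard'
  set a : ℝ := ∑ j, x.1 j ^ 4
  set b : ℝ := ∑ j : Fin n, (x.2 j ^ 2 - β * (j + 1) / (n + 1)) ^ 4
  have ha : 0 ≤ a := Finset.sum_nonneg fun _ _ => by positivity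
  have hb : 0 ≤ b := Finset.sum_nonneg fun _ _ => by positivity
  have hD : tridiagDefect β x = (a + b) / (n + 1) := rfl
  rw [hD, div_le_iff₀ hN, add_mul, add_mul, div_mul_cancel₀ _ hN.ne', mul_assoc,
    div_mul_cancel₀ _ hN.ne']
  refine hcard''.trans ?_
  have hr : (0 : ℝ) ≤ 2 * r + 1 := by positivity
  have e₁ := mul_le_mul_of_nonneg_right hA hr
  have e₂ := mul_le_mul_of_nonneg_right hB hr
  -- The stated bound multiplies the sum of both constants by the whole defect; the extra cross
  -- terms are nonnegative.
  have e₃ : 0 ≤ 1 / ε ^ 4 * b * (2 * r + 1) := by positivity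
  have e₄ : 0 ≤ 1 / (ε ^ 2 / 2) ^ 4 * a * (2 * r + 1) := by positivity
  linarith

/-- The Riemann sum is the integral of the step function `u ↦ g (⌊uN⌋ / N)` with `N = n + 1`, and
dominated convergence applies. This tolerates a discontinuity of `g` at `0`, which does occur for
integer lines. -/
theorem tendsto_sum_div_integral {g : ℝ → ℝ} {M : ℝ} (hM : ∀ u, |g u| ≤ M)
    (hg : ContinuousOn g (Set.Ioi 0)) :
    Tendsto (fun n : ℕ => (∑ o : Fin (n + 1), g ((o : ℝ) / (n + 1))) / (n + 1)) atTop
      (𝓝 (∫ u in (0 : ℝ)..1, g u)) := by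
  have hmeas : ∀ n : ℕ, Measurable fun u : ℝ => g ((⌊u * (n + 1)⌋₊ : ℝ) / (n + 1)) := by
    intro n
    have : Measurable fun u : ℝ => ⌊u * ((n : ℝ) + 1)⌋₊ :=
      Nat.measurable_floor.comp (measurable_id.mul_const _)
    exact (measurable_from_top (f := fun k : ℕ => g ((k : ℝ) / (n + 1)))).comp this
  have hsum : ∀ n : ℕ, (∑ o : Fin (n + 1), g ((o : ℝ) / (n + 1))) / (n + 1) =
      ∫ u in (0 : ℝ)..1, g ((⌊u * (n + 1)⌋₊ : ℝ) / (n + 1)) := by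
    intro n
    have hN : (0 : ℝ) < n + 1 := by positivity
    have h := intervalIntegral.sum_integral_adjacent_intervals
      (f := fun u : ℝ => g ((⌊u * (n + 1)⌋₊ : ℝ) / (n + 1))) (μ := volume)
      (a := fun k : ℕ => (k : ℝ) / (n + 1)) (n := n + 1) (fun k _ => by
        refine (intervalIntegrable_const (c := M)).mono_fun
          (hmeas n).aestronglyMeasurable (Eventually.of_forall fun u => ?_)
        exact (hM _).trans (le_abs_self M))
    simp only [Nat.cast_add, Nat.cast_one, div_self hN.ne', Nat.cast_zero, zero_div] at h
    rw [← h, Finset.sum_div, Finset.sum_range fun k : ℕ => ∫ u in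
      (k : ℝ) / (n + 1)..((k : ℝ) + 1) / (n + 1), g ((⌊u * (n + 1)⌋₊ : ℝ) / (n + 1))]
    refine Finset.sum_congr rfl fun k _ => ?_
    have hle : (k : ℝ) / (n + 1) ≤ ((k : ℝ) + 1) / (n + 1) := by gcongr; linarith
    have : ∫ u in (k : ℝ) / (n + 1)..((k : ℝ) + 1) / (n + 1), g ((⌊u * (n + 1)⌋₊ : ℝ) / (n + 1)) =
        ∫ u in (k : ℝ) / (n + 1)..((k : ℝ) + 1) / (n + 1), g ((k : ℝ) / (n + 1)) := by
      rw [intervalIntegral.integral_of_le hle, intervalIntegral.integral_of_le hle,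
        ← integral_Ico_eq_integral_Ioc, ← integral_Ico_eq_integral_Ioc]
      refine setIntegral_congr_fun measurableSet_Ico fun u hu => ?_
      have hu1 := (div_le_iff₀ hN).1 hu.1
      have hu2 := (lt_div_iff₀ hN).1 hu.2
      have : ⌊u * ((n : ℝ) + 1)⌋₊ = (k : ℕ) :=
        (Nat.floor_eq_iff ((Nat.cast_nonneg _).trans hu1)).2 ⟨hu1, hu2⟩
      simp only [this]
    rw [this, intervalIntegral.integral_const, smul_eq_mul, ← sub_div, add_sub_cancel_left,
      one_div, inv_mul_eq_div]
  simp_rw [hsum]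
  refine intervalIntegral.tendsto_integral_filter_of_dominated_convergence (fun _ => M)
    (Eventually.of_forall fun n => (hmeas n).aestronglyMeasurable)
    (Eventually.of_forall fun n => Eventually.of_forall fun u _ => hM _)
    intervalIntegrable_const (Eventually.of_forall fun u hu => ?_)
  rw [Set.uIoc_of_le zero_le_one] at hu
  refine ((hg u hu.1).continuousAt (Ioi_mem_nhds hu.1)).tendsto.comp ?_
  have h := (tendsto_nat_floor_mul_div_atTop hu.1.le).comp
    (tendsto_natCast_atTop_atTop.comp (tendsto_add_atTop_nat 1))
  simpa [Function.comp_def] using h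

theorem integral_unitInterval (g : ℝ → ℝ) :
    ∫ u : unitInterval, g u = ∫ u in (0 : ℝ)..1, g u := by
  rw [intervalIntegral.integral_of_le zero_le_one, ← integral_Icc_eq_integral_Ioc]
  exact unitInterval.measurePreserving_coe.integral_comp unitInterval.measurableEmbedding_coe g

theorem tendsto_average_tridiagRootedGraph {β : ℝ} (hβ : 0 < β)
    {x : ∀ n : ℕ, (Fin (n + 1) → ℝ) × (Fin n → ℝ)} (hx : ∀ n j, 0 < (x n).2 j)
    (hD : Tendsto (fun n => tridiagDefect β (x n)) atTop (𝓝 0))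
    {f : RootedGraphClass → ℝ} (hf : Continuous f) {M : ℝ} (hM : ∀ G, |f G| ≤ M) :
    Tendsto (fun n : ℕ => (∑ o, f (tridiagRootedGraph (x n) o).toClass) / ((n : ℝ) + 1)) atTop
      (𝓝 (∫ u : unitInterval, f (integerLine √(β * u)).toClass)) := by
  classical
  have hcont : ContinuousOn (fun u : ℝ => f (integerLine √(β * u)).toClass) (Set.Ioi 0) := by
    refine hf.comp_continuousOn (continuousOn_integerLine.comp
      (Real.continuous_sqrt.comp (continuous_const.mul continuous_id)).continuousOn ?_)
    intro u hu
    exact (Real.sqrt_pos.2 (mul_pos hβ hu)).ne'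
  have hR := tendsto_sum_div_integral (fun u => hM _) hcont
  rw [integral_unitInterval fun u => f (integerLine √(β * u)).toClass]
  refine tendsto_of_tendsto_of_dist hR ?_
  have hM0 : 0 ≤ M := (abs_nonneg _).trans (hM (integerLine 0).toClass)
  rw [Metric.tendsto_nhds]
  intro δ hδ
  -- A proportion at most `2η` of bad roots, each costing `2M`, contributes `4Mη = (δ / 2) · M / (M
  -- + 1) < δ / 2`.
  set η : ℝ := δ / (8 * (M + 1)) with hηdef
  have hη : 0 < η := by positivity
  -- Uniform control of `f` needs weights in a compact interval away from `0`; this is why positions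
  -- below `η` count as bad.
  obtain ⟨r, ε, hε, hr⟩ := exists_locallyClose_integerLine_abs_lt hf
    (Real.sqrt_pos.2 (mul_pos hβ hη)) √β (half_pos hδ)
  have hlim : Tendsto (fun n : ℕ => η + (2 * r + 1) / ((n : ℝ) + 1) +
      (2 * r + 1) * (1 / ε ^ 4 + 1 / (ε ^ 2 / 2) ^ 4) * tridiagDefect β (x n)) atTop (𝓝 η) := by
    have h₁ : Tendsto (fun n : ℕ => (2 * (r : ℝ) + 1) / ((n : ℝ) + 1)) atTop (𝓝 0) :=
      tendsto_const_nhds.div_atTop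
        (tendsto_atTop_add_const_right _ _ tendsto_natCast_atTop_atTop)
    simpa only [add_zero, mul_zero] using (h₁.const_add η).add
      (hD.const_mul ((2 * r + 1) * (1 / ε ^ 4 + 1 / (ε ^ 2 / 2) ^ 4)))
  have hn : ∀ᶠ n : ℕ in atTop, β * (r + 1) / ((n : ℝ) + 1) < ε ^ 2 / 2 := by
    have h₁ : Tendsto (fun n : ℕ => β * (r + 1) / ((n : ℝ) + 1)) atTop (𝓝 0) :=
      tendsto_const_nhds.div_atTop
        (tendsto_atTop_add_const_right _ _ tendsto_natCast_atTop_atTop)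
    exact h₁.eventually_lt_const (by positivity)
  filter_upwards [hn, hlim.eventually_lt_const (by linarith : η < 2 * η)] with n hn hlt
  have hN : (0 : ℝ) < n + 1 := by positivity
  have hcard := (card_not_locallyClose_le hβ (hx n) hε hη hn).trans hlt.le
  set bad := Finset.univ.filter fun o : Fin (n + 1) => ¬ (η ≤ (o : ℝ) / (n + 1) ∧
        LocallyClose r ε (integerLine √(β * ((o : ℝ) / (n + 1)))) (tridiagRootedGraph (x n) o))
  have hterm : ∀ o : Fin (n + 1), |f (integerLine √(β * ((o : ℝ) / (n + 1)))).toClass -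
      f (tridiagRootedGraph (x n) o).toClass| ≤ δ / 2 + if o ∈ bad then 2 * M else 0 := by
    intro o
    split_ifs with ho
    · have h₁ := hM (integerLine √(β * ((o : ℝ) / (n + 1)))).toClass
      have h₂ := hM (tridiagRootedGraph (x n) o).toClass
      have := abs_sub (f (integerLine √(β * ((o : ℝ) / (n + 1)))).toClass)
        (f (tridiagRootedGraph (x n) o).toClass)
      linarith
    · simp only [bad, Finset.mem_filter, Finset.mem_univ, true_and, not_not] at ho
      rw [add_zero, abs_sub_comm]
      refine (hr _ ⟨?_, ?_⟩ _ ho.2).le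
      · exact Real.sqrt_le_sqrt (by gcongr; exact ho.1)
      · refine Real.sqrt_le_sqrt (mul_le_of_le_one_right hβ.le ?_)
        rw [div_le_one hN]
        have : (o : ℕ) ≤ n + 1 := o.isLt.le
        exact_mod_cast this
  rw [Real.dist_0_eq_abs, abs_of_nonneg dist_nonneg, Real.dist_eq, ← sub_div, abs_div,
    abs_of_pos hN, ← Finset.sum_sub_distrib]
  calc _ ≤ (∑ o : Fin (n + 1), (δ / 2 + if o ∈ bad then 2 * M else 0)) / ((n : ℝ) + 1) := by
        gcongr
        exact (Finset.abs_sum_le_sum_abs _ _).trans (Finset.sum_le_sum fun o _ => hterm o)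
    _ = δ / 2 + 2 * M * (bad.card / ((n : ℝ) + 1)) := by
        rw [Finset.sum_add_distrib]
        simp only [Finset.sum_const, Finset.card_univ, Fintype.card_fin, nsmul_eq_mul,
          Finset.sum_ite_mem, Finset.univ_inter]
        push_cast
        field_simp
    _ ≤ δ / 2 + 2 * M * (2 * η) := by gcongr
    _ < δ := by
        have : M * η ≤ δ / 8 * (M / (M + 1)) := by
          rw [hηdef]
          apply le_of_eq
          field_simp
        have h2 : M / (M + 1) < 1 := by rw [div_lt_one (by positivity)]; linarith
        nlinarith

/-! ## Moments of the entries -/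

/-- By `Γ(s + 1) = s Γ(s)`, multiplying the density by `x` raises the shape by one. All moments
follow by recursion. -/
theorem gammaPDFReal_mul_self {s r : ℝ} (hs : 0 < s) (hr : 0 < r) (x : ℝ) :
    x * gammaPDFReal s r x = s / r * gammaPDFReal (s + 1) r x := by
  unfold gammaPDFReal
  split_ifs with hx
  · rcases hx.eq_or_lt with rfl | hx
    · simp [Real.zero_rpow hs.ne']
    · rw [Real.Gamma_add_one hs.ne', Real.rpow_add_one hr.ne', add_sub_cancel_right,
        show x ^ s = x ^ (s - 1) * x by rw [← Real.rpow_add_one hx.ne', sub_add_cancel]]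
      have := (Real.Gamma_pos_of_pos hs).ne'
      field_simp
  · simp

theorem measurable_gammaPDF (s r : ℝ) : Measurable (gammaPDF s r) :=
  (measurable_gammaPDFReal s r).ennreal_ofReal

theorem integrable_gammaMeasure_iff {s r : ℝ} (hs : 0 < s) (hr : 0 < r) (g : ℝ → ℝ) :
    Integrable g (gammaMeasure s r) ↔ Integrable fun x => g x * gammaPDFReal s r x := by
  rw [gammaMeasure, integrable_withDensity_iff (measurable_gammaPDF s r)
    (Eventually.of_forall fun x => ENNReal.ofReal_lt_top)]
  simp only [gammaPDF, ENNReal.toReal_ofReal (gammaPDFReal_nonneg hs hr _)]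

theorem integral_gammaMeasure {s r : ℝ} (hs : 0 < s) (hr : 0 < r) (g : ℝ → ℝ) :
    ∫ x, g x ∂(gammaMeasure s r) = ∫ x, g x * gammaPDFReal s r x := by
  rw [gammaMeasure, integral_withDensity_eq_integral_toReal_smul (measurable_gammaPDF s r)
    (Eventually.of_forall fun x => ENNReal.ofReal_lt_top)]
  simp only [gammaPDF, ENNReal.toReal_ofReal (gammaPDFReal_nonneg hs hr _), smul_eq_mul, mul_comm]

theorem integrable_pow_gammaMeasure {s r : ℝ} (hs : 0 < s) (hr : 0 < r) (m : ℕ) :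
    Integrable (fun x => x ^ m) (gammaMeasure s r) := by
  induction m generalizing s with
  | zero =>
    have := isProbabilityMeasure_gammaMeasure hs hr
    simp
  | succ m ih =>
    have h := ((integrable_gammaMeasure_iff (add_pos hs one_pos) hr _).1
      (ih (add_pos hs one_pos))).const_mul (s / r)
    refine (integrable_gammaMeasure_iff hs hr _).2 (h.congr (Eventually.of_forall fun x => ?_))
    simp only
    rw [pow_succ, mul_assoc, gammaPDFReal_mul_self hs hr]
    ring

theorem integral_pow_gammaMeasure {s r : ℝ} (hs : 0 < s) (hr : 0 < r) (m : ℕ) :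
    ∫ x, x ^ (m + 1) ∂(gammaMeasure s r) = s / r * ∫ x, x ^ m ∂(gammaMeasure (s + 1) r) := by
  rw [integral_gammaMeasure hs hr, integral_gammaMeasure (add_pos hs one_pos) hr,
    ← integral_const_mul]
  refine integral_congr_ae (Eventually.of_forall fun x => ?_)
  simp only
  rw [pow_succ, mul_assoc, gammaPDFReal_mul_self hs hr]
  ring

theorem integrable_chiSquared_sub_pow_four {k : ℝ} (hk : 0 < k) :
    Integrable (fun x => (x - k) ^ 4) (gammaMeasure (k / 2) (1 / 2)) := by
  have hi := fun m => integrable_pow_gammaMeasure (half_pos hk) (half_pos one_pos) m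
  have h := ((((hi 4).sub ((hi 3).const_mul (4 * k))).add ((hi 2).const_mul (6 * k ^ 2))).sub
    ((hi 1).const_mul (4 * k ^ 3))).add ((hi 0).const_mul (k ^ 4))
  refine h.congr (Eventually.of_forall fun x => ?_)
  simp only [Pi.add_apply, Pi.sub_apply]
  ring

/-- The raw moments are `k`, `k(k+2)`, `k(k+2)(k+4)`, `k(k+2)(k+4)(k+6)`. The terms of degree `4`
and `3` in `k` cancel; being quadratic, the result is `O(N⁻²)` after division by `N⁴` when `k =
O(N)`. -/
theorem integral_chiSquared_sub_pow_four {k : ℝ} (hk : 0 < k) :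
    ∫ x, (x - k) ^ 4 ∂(gammaMeasure (k / 2) (1 / 2)) = 12 * k ^ 2 + 48 * k := by
  have hh : (0 : ℝ) < 1 / 2 := half_pos one_pos
  have hi := fun m => integrable_pow_gammaMeasure (half_pos hk) hh m
  have h0 : ∀ s : ℝ, 0 < s → ∫ x, x ^ 0 ∂(gammaMeasure s (1 / 2)) = 1 := fun s hs => by
    have := isProbabilityMeasure_gammaMeasure hs hh
    simp only [pow_zero, integral_const, probReal_univ, smul_eq_mul, mul_one]
  have h1 : ∀ s : ℝ, 0 < s → ∫ x, x ^ 1 ∂(gammaMeasure s (1 / 2)) = 2 * s := fun s hs => by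
    rw [integral_pow_gammaMeasure hs hh 0, h0 _ (by linarith)]
    ring
  have h2 : ∀ s : ℝ, 0 < s → ∫ x, x ^ 2 ∂(gammaMeasure s (1 / 2)) = 2 * s * (2 * (s + 1)) :=
    fun s hs => by
    rw [integral_pow_gammaMeasure hs hh 1, h1 _ (by linarith)]
    ring
  have h3 : ∀ s : ℝ, 0 < s → ∫ x, x ^ 3 ∂(gammaMeasure s (1 / 2)) =
      2 * s * (2 * (s + 1) * (2 * (s + 2))) := fun s hs => by
    rw [integral_pow_gammaMeasure hs hh 2, h2 _ (by linarith)]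
    ring
  have h4 : ∀ s : ℝ, 0 < s → ∫ x, x ^ 4 ∂(gammaMeasure s (1 / 2)) =
      2 * s * (2 * (s + 1) * (2 * (s + 2) * (2 * (s + 3)))) := fun s hs => by
    rw [integral_pow_gammaMeasure hs hh 3, h3 _ (by linarith)]
    ring
  have he : ∀ x : ℝ, (x - k) ^ 4 = x ^ 4 - 4 * k * x ^ 3 + 6 * k ^ 2 * x ^ 2 - 4 * k ^ 3 * x ^ 1 +
      k ^ 4 * x ^ 0 := fun x => by ring
  simp_rw [he]
  have i₁ : Integrable (fun x => x ^ 4 - 4 * k * x ^ 3) (gammaMeasure (k / 2) (1 / 2)) :=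
    (hi 4).sub ((hi 3).const_mul (4 * k))
  have i₂ : Integrable (fun x => x ^ 4 - 4 * k * x ^ 3 + 6 * k ^ 2 * x ^ 2)
    (gammaMeasure (k / 2) (1 / 2)) := i₁.add ((hi 2).const_mul (6 * k ^ 2))
  have i₃ : Integrable (fun x => x ^ 4 - 4 * k * x ^ 3 + 6 * k ^ 2 * x ^ 2 - 4 * k ^ 3 * x ^ 1)
    (gammaMeasure (k / 2) (1 / 2)) := i₂.sub ((hi 1).const_mul (4 * k ^ 3))
  rw [integral_add i₃ ((hi 0).const_mul (k ^ 4)), integral_sub i₂ ((hi 1).const_mul (4 * k ^ 3)),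
    integral_add i₁ ((hi 2).const_mul (6 * k ^ 2)), integral_sub (hi 4) ((hi 3).const_mul (4 * k))]
  simp only [integral_const_mul]
  rw [h0 _ (half_pos hk), h1 _ (half_pos hk), h2 _ (half_pos hk), h3 _ (half_pos hk),
    h4 _ (half_pos hk)]
  ring

theorem ae_pos_gammaMeasure (s r : ℝ) : ∀ᵐ x ∂(gammaMeasure s r), 0 < x := by
  rw [gammaMeasure, ae_withDensity_iff (measurable_gammaPDF s r)]
  filter_upwards [Measure.ae_ne volume (0 : ℝ)] with x hx hx'
  by_contra! h
  exact hx' (gammaPDF_of_neg (lt_of_le_of_ne h hx))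

theorem isProbabilityMeasure_chiLaw {k : ℝ} (hk : 0 < k) : IsProbabilityMeasure (chiLaw k) := by
  have := isProbabilityMeasure_gammaMeasure (half_pos hk) (half_pos one_pos)
  exact Measure.isProbabilityMeasure_map Real.continuous_sqrt.measurable.aemeasurable

/-! ### Laws of the matrix entries and expectation of the defect -/

/-- The law of the `j`-th edge weight of the `β`-Hermite matrix of size `n + 1`. -/
noncomputable def hermiteEdgeLaw (β : ℝ) (n : ℕ) (j : Fin n) : Measure ℝ :=
  (chiLaw (β * ((j : ℝ) + 1))).map fun x => x / √((n : ℝ) + 1)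

/-- The law of the loop weights of the `β`-Hermite matrix of size `n + 1`. -/
noncomputable def hermiteLoopLaw (n : ℕ) : Measure ℝ :=
  (gaussianReal 0 2).map fun x => x / √((n : ℝ) + 1)

instance isProbabilityMeasure_hermiteLoopLaw (n : ℕ) : IsProbabilityMeasure (hermiteLoopLaw n) :=
  Measure.isProbabilityMeasure_map (by fun_prop)

theorem hermiteEdgeLaw_eq (β : ℝ) (n : ℕ) (j : Fin n) : hermiteEdgeLaw β n j =
    (gammaMeasure (β * ((j : ℝ) + 1) / 2) (1 / 2)).map fun x => √x / √((n : ℝ) + 1) := by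
  rw [hermiteEdgeLaw, chiLaw, Measure.map_map (by fun_prop) (by fun_prop)]
  rfl

theorem isProbabilityMeasure_hermiteEdgeLaw {β : ℝ} (hβ : 0 < β) (n : ℕ) (j : Fin n) :
    IsProbabilityMeasure (hermiteEdgeLaw β n j) := by
  have := isProbabilityMeasure_chiLaw (mul_pos hβ (Nat.cast_add_one_pos (α := ℝ) (j : ℕ)))
  exact Measure.isProbabilityMeasure_map (by fun_prop)

theorem hasLaw_loop {β : ℝ} (hβ : 0 < β) (n : ℕ) (j : Fin (n + 1)) :
    HasLaw (fun x : (Fin (n + 1) → ℝ) × (Fin n → ℝ) => x.1 j) (hermiteLoopLaw n)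
      (hermiteEntriesLaw β n) := by
  have := isProbabilityMeasure_hermiteEdgeLaw hβ n
  exact ((measurePreserving_eval (fun _ => hermiteLoopLaw n) j).comp
    (measurePreserving_fst (μ := Measure.pi fun _ : Fin (n + 1) => hermiteLoopLaw n)
      (ν := Measure.pi (hermiteEdgeLaw β n)))).hasLaw

theorem hasLaw_edge {β : ℝ} (hβ : 0 < β) (n : ℕ) (j : Fin n) :
    HasLaw (fun x : (Fin (n + 1) → ℝ) × (Fin n → ℝ) => x.2 j) (hermiteEdgeLaw β n j)
      (hermiteEntriesLaw β n) := by
  have := isProbabilityMeasure_hermiteEdgeLaw hβ n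
  exact ((measurePreserving_eval (hermiteEdgeLaw β n) j).comp
    (measurePreserving_snd (μ := Measure.pi fun _ : Fin (n + 1) => hermiteLoopLaw n)
      (ν := Measure.pi (hermiteEdgeLaw β n)))).hasLaw

/-- Almost surely no edge is missing, so the graph is a path and the deterministic estimates apply.
-/
theorem ae_pos_edge {β : ℝ} (hβ : 0 < β) (n : ℕ) :
    ∀ᵐ x ∂(hermiteEntriesLaw β n), ∀ j, 0 < x.2 j := by
  rw [ae_all_iff]
  intro j
  have h : ∀ᵐ y ∂(hermiteEdgeLaw β n j), 0 < y := by
    rw [hermiteEdgeLaw_eq, ae_map_iff (by fun_prop) measurableSet_Ioi]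
    filter_upwards [ae_pos_gammaMeasure _ _] with x hx
    exact div_pos (Real.sqrt_pos.2 hx) (Real.sqrt_pos.2 (by positivity))
  exact ((hasLaw_edge hβ n j).ae_iff (p := fun y => 0 < y) (measurableSet_Ioi (a := (0 : ℝ))).mem).2 h

theorem integrable_loop_pow_four (n : ℕ) :
    Integrable (fun y => y ^ 4) (hermiteLoopLaw n) := by
  rw [hermiteLoopLaw, integrable_map_measure (by fun_prop) (by fun_prop)]
  have h := ((memLp_id_gaussianReal (μ := 0) (v := 2) 4).integrable_norm_pow
    (by norm_num)).div_const ((n + 1 : ℝ) ^ 2)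
  refine h.congr (Eventually.of_forall fun x => ?_)
  simp only [Function.comp, id, Real.norm_eq_abs, div_pow]
  rw [show √((n : ℝ) + 1) ^ 4 = (√((n : ℝ) + 1) ^ 2) ^ 2 by ring, Real.sq_sqrt (by positivity),
    Even.pow_abs (by decide)]

/-- The Gaussian fourth moment stays unevaluated: only the factor `(n + 1)⁻²` matters. -/
theorem integral_loop_pow_four (n : ℕ) :
    ∫ y, y ^ 4 ∂(hermiteLoopLaw n) = (∫ x, x ^ 4 ∂(gaussianReal 0 2)) / (n + 1) ^ 2 := by
  rw [hermiteLoopLaw, integral_map (by fun_prop) (by fun_prop), ← integral_div]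
  refine integral_congr_ae (Eventually.of_forall fun x => ?_)
  simp only [div_pow]
  rw [show √((n : ℝ) + 1) ^ 4 = (√((n : ℝ) + 1) ^ 2) ^ 2 by ring, Real.sq_sqrt (by positivity)]

theorem edge_pow_four_ae_eq (β : ℝ) (n : ℕ) (j : Fin n) :
    (fun x => ((√x / √((n : ℝ) + 1)) ^ 2 - β * (j + 1) / (n + 1)) ^ 4)
      =ᵐ[gammaMeasure (β * ((j : ℝ) + 1) / 2) (1 / 2)]
    fun x => (x - β * (j + 1)) ^ 4 / (n + 1) ^ 4 := by
  filter_upwards [ae_pos_gammaMeasure _ _] with x hx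
  rw [div_pow, Real.sq_sqrt hx.le, Real.sq_sqrt (by positivity), ← sub_div, div_pow]

theorem integrable_edge_pow_four {β : ℝ} (hβ : 0 < β) (n : ℕ) (j : Fin n) :
    Integrable (fun y => (y ^ 2 - β * (j + 1) / (n + 1)) ^ 4) (hermiteEdgeLaw β n j) := by
  rw [hermiteEdgeLaw_eq, integrable_map_measure (by fun_prop) (by fun_prop)]
  exact ((integrable_chiSquared_sub_pow_four (by positivity)).div_const _).congr
    (edge_pow_four_ae_eq β n j).symm

theorem integral_edge_pow_four {β : ℝ} (hβ : 0 < β) (n : ℕ) (j : Fin n) :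
    ∫ y, (y ^ 2 - β * (j + 1) / (n + 1)) ^ 4 ∂(hermiteEdgeLaw β n j) =
      (12 * (β * (j + 1)) ^ 2 + 48 * (β * (j + 1))) / (n + 1) ^ 4 := by
  rw [hermiteEdgeLaw_eq, integral_map (by fun_prop) (by fun_prop),
    integral_congr_ae (edge_pow_four_ae_eq β n j), integral_div,
    integral_chiSquared_sub_pow_four (by positivity)]

theorem integrable_loop_entry {β : ℝ} (hβ : 0 < β) (n : ℕ) (j : Fin (n + 1)) :
    Integrable (fun x : (Fin (n + 1) → ℝ) × (Fin n → ℝ) => x.1 j ^ 4)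
      (hermiteEntriesLaw β n) := by
  have h := integrable_loop_pow_four n
  rw [← (hasLaw_loop hβ n j).map_eq] at h
  exact h.comp_aemeasurable (hasLaw_loop hβ n j).aemeasurable

theorem integrable_edge_entry {β : ℝ} (hβ : 0 < β) (n : ℕ) (j : Fin n) :
    Integrable (fun x : (Fin (n + 1) → ℝ) × (Fin n → ℝ) =>
      (x.2 j ^ 2 - β * (j + 1) / (n + 1)) ^ 4) (hermiteEntriesLaw β n) := by
  have h := integrable_edge_pow_four hβ n j
  rw [← (hasLaw_edge hβ n j).map_eq] at h
  exact h.comp_aemeasurable (hasLaw_edge hβ n j).aemeasurable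

theorem integrable_tridiagDefect {β : ℝ} (hβ : 0 < β) (n : ℕ) :
    Integrable (tridiagDefect β) (hermiteEntriesLaw β n) :=
  ((integrable_finsetSum _ fun j _ => integrable_loop_entry hβ n j).add
    (integrable_finsetSum _ fun j _ => integrable_edge_entry hβ n j)).div_const _

/-- Each loop and each edge contributes `O(N⁻²)` in fourth mean, and averaging keeps this order,
which is summable in `N`. -/
theorem integral_tridiagDefect_le {β : ℝ} (hβ : 0 < β) (n : ℕ) :
    ∫ x, tridiagDefect β x ∂(hermiteEntriesLaw β n) ≤
      ((∫ x, x ^ 4 ∂(gaussianReal 0 2)) + (12 * β ^ 2 + 48 * β)) / ((n : ℝ) + 1) ^ 2 := by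
  have hN : (0 : ℝ) < n + 1 := by positivity
  have hi₁ := integrable_loop_entry hβ n
  have hi₂ := integrable_edge_entry hβ n
  have he₁ : ∀ j, ∫ x, x.1 j ^ 4 ∂(hermiteEntriesLaw β n) =
      (∫ x, x ^ 4 ∂(gaussianReal 0 2)) / (n + 1) ^ 2 := fun j => by
    rw [← integral_loop_pow_four]
    exact (hasLaw_loop hβ n j).integral_comp (f := fun y => y ^ 4) (by fun_prop)
  have he₂ : ∀ j : Fin n, ∫ x, (x.2 j ^ 2 - β * (j + 1) / (n + 1)) ^ 4 ∂(hermiteEntriesLaw β n) ≤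
      (12 * β ^ 2 + 48 * β) / (n + 1) ^ 2 := fun j => by
    rw [show ∫ x, (x.2 j ^ 2 - β * (j + 1) / (n + 1)) ^ 4 ∂(hermiteEntriesLaw β n) =
      ∫ y, (y ^ 2 - β * (j + 1) / (n + 1)) ^ 4 ∂(hermiteEdgeLaw β n j) from
      (hasLaw_edge hβ n j).integral_comp (f := fun y => (y ^ 2 - β * (j + 1) / (n + 1)) ^ 4)
        (by fun_prop), integral_edge_pow_four hβ, div_le_div_iff₀ (by positivity) (by positivity)]
    have hj : (j : ℝ) + 1 ≤ n + 1 := by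
      have : (j : ℕ) ≤ n := j.isLt.le
      gcongr
    have hj0 : (0 : ℝ) ≤ (j : ℝ) + 1 := by positivity
    have h1 : (1 : ℝ) ≤ n + 1 := by linarith [(Nat.cast_nonneg n : (0 : ℝ) ≤ n)]
    have h2 : (β * ((j : ℝ) + 1)) ^ 2 ≤ β ^ 2 * (n + 1) ^ 2 := by
      rw [mul_pow]
      gcongr
    -- The linear term is bounded crudely to match the quadratic one.
    have h3 : β * ((j : ℝ) + 1) ≤ β * (n + 1) ^ 2 := by
      gcongr
      nlinarith
    calc _ ≤ (12 * (β ^ 2 * ((n : ℝ) + 1) ^ 2) + 48 * (β * (n + 1) ^ 2)) * ((n : ℝ) + 1) ^ 2 := by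
          gcongr
      _ = _ := by ring
  unfold tridiagDefect
  rw [integral_div, integral_add (integrable_finsetSum _ fun j _ => hi₁ j)
    (integrable_finsetSum _ fun j _ => hi₂ j), integral_finsetSum _ fun j _ => hi₁ j,
    integral_finsetSum _ fun j _ => hi₂ j, div_le_iff₀ hN]
  simp only [he₁]
  have hs := Finset.sum_le_sum (s := Finset.univ) fun j _ => he₂ j
  simp only [Finset.sum_const, Finset.card_univ, Fintype.card_fin, nsmul_eq_mul] at hs ⊢
  have : 0 ≤ (12 * β ^ 2 + 48 * β) / ((n : ℝ) + 1) ^ 2 := by positivity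
  push_cast
  rw [add_div]
  linarith

/-- The defects of `β`-Hermite matrices tend to `0` almost surely, whatever their joint law. -/
theorem ae_tendsto_tridiagDefect {β : ℝ} (hβ : 0 < β) {Ω : Type*} [MeasurableSpace Ω]
    {P : Measure Ω} {X : ∀ n : ℕ, Ω → (Fin (n + 1) → ℝ) × (Fin n → ℝ)}
    (hX : ∀ n, HasLaw (X n) (hermiteEntriesLaw β n) P) :
    ∀ᵐ ω ∂P, Tendsto (fun n => tridiagDefect β (X n ω)) atTop (𝓝 0) := by
  have h0 : ∀ n (x : (Fin (n + 1) → ℝ) × (Fin n → ℝ)), 0 ≤ tridiagDefect β x := fun n x =>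
    div_nonneg (add_nonneg (Finset.sum_nonneg fun _ _ => by positivity)
      (Finset.sum_nonneg fun _ _ => by positivity)) (by positivity)
  have hint : ∀ n, Integrable (fun ω => tridiagDefect β (X n ω)) P := fun n => by
    have h := integrable_tridiagDefect hβ n
    rw [← (hX n).map_eq] at h
    exact h.comp_aemeasurable (hX n).aemeasurable
  set C : ℝ := (∫ x, x ^ 4 ∂(gaussianReal 0 2)) + (12 * β ^ 2 + 48 * β)
  have hle : ∀ n, ∫⁻ ω, ENNReal.ofReal (tridiagDefect β (X n ω)) ∂P ≤
      ENNReal.ofReal (C / ((n : ℝ) + 1) ^ 2) := fun n => by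
    rw [← ofReal_integral_eq_lintegral_ofReal (hint n) (Eventually.of_forall fun ω => h0 n _)]
    refine ENNReal.ofReal_le_ofReal ?_
    rw [show ∫ ω, tridiagDefect β (X n ω) ∂P = ∫ x, tridiagDefect β x ∂(hermiteEntriesLaw β n) from
      (hX n).integral_comp (integrable_tridiagDefect hβ n).aestronglyMeasurable]
    exact integral_tridiagDefect_le hβ n
  have hC : 0 ≤ C := add_nonneg (integral_nonneg fun x => by positivity) (by positivity)
  have hsum : Summable fun n : ℕ => C / ((n : ℝ) + 1) ^ 2 := by
    have h := ((summable_nat_add_iff 1).2 (Real.summable_nat_pow_inv.2 one_lt_two)).mul_left C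
    simpa [div_eq_mul_inv] using h
  -- Tonelli uses only the law of each `X n` separately, so the joint law is irrelevant. A series
  -- with finite expectation converges almost surely, and its terms tend to `0`.
  have hfin : ∫⁻ ω, ∑' n, ENNReal.ofReal (tridiagDefect β (X n ω)) ∂P ≠ ∞ := by
    rw [lintegral_tsum fun n => (hint n).aemeasurable.ennreal_ofReal]
    refine ne_top_of_le_ne_top ?_ (ENNReal.tsum_le_tsum hle)
    rw [← ENNReal.ofReal_tsum_of_nonneg (fun n => by positivity) hsum]
    exact ENNReal.ofReal_ne_top
  filter_upwards [ae_lt_top' (AEMeasurable.tsum fun n =>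
    (hint n).aemeasurable.ennreal_ofReal) hfin] with ω hω
  have h := (ENNReal.tendsto_toReal ENNReal.zero_ne_top).comp
    (ENNReal.tendsto_atTop_zero_of_tsum_ne_top hω.ne)
  simpa [Function.comp_def, ENNReal.toReal_ofReal (h0 _ _)] using h

/-! ## Benjamini–Schramm convergence -/

theorem tendstoInDistribution_of_forall_integral {Ω : ℕ → Type*} [∀ n, MeasurableSpace (Ω n)]
    {Ω' : Type*} [MeasurableSpace Ω'] {E : Type*} [TopologicalSpace E] [MeasurableSpace E]
    [BorelSpace E] {X : ∀ n, Ω n → E} {μ : ∀ n, Measure (Ω n)} [∀ n, IsProbabilityMeasure (μ n)]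
    {Z : Ω' → E} {μ' : Measure Ω'} [IsProbabilityMeasure μ']
    (hX : ∀ n, AEMeasurable (X n) (μ n)) (hZ : AEMeasurable Z μ')
    (h : ∀ f : E → ℝ, Continuous f → ∀ M, (∀ y, |f y| ≤ M) →
      Tendsto (fun n => ∫ ω, f (X n ω) ∂(μ n)) atTop (𝓝 (∫ ω, f (Z ω) ∂μ'))) :
    TendstoInDistribution X atTop Z μ μ' where
  forall_aemeasurable := hX
  aemeasurable_limit := hZ
  tendsto := by
    refine ProbabilityMeasure.tendsto_iff_forall_integral_tendsto.2 fun f => ?_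
    have h := h f f.continuous ‖f‖ f.norm_coe_le_norm
    simp only [ProbabilityMeasure.coe_mk]
    rw [integral_map hZ f.continuous.measurable.aestronglyMeasurable]
    refine h.congr fun n => ?_
    rw [integral_map (hX n) f.continuous.measurable.aestronglyMeasurable]

theorem integral_uniformOn_univ_fin (n : ℕ) (g : Fin (n + 1) → ℝ) :
    ∫ o, g o ∂(uniformOn (Set.univ : Set (Fin (n + 1)))) = (∑ o, g o) / ((n : ℝ) + 1) := by
  rw [integral_fintype Integrable.of_finite, Finset.sum_div]
  refine Finset.sum_congr rfl fun o _ => ?_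
  rw [measureReal_def, uniformOn_univ]
  simp only [Measure.count_singleton, Fintype.card_fin, one_div, ENNReal.toReal_inv, smul_eq_mul,
    inv_mul_eq_div]
  rw [ENNReal.toReal_natCast, Nat.cast_add_one]

/-- Serves the maps into graph classes, whose continuity is established only off the null set where
an edge weight vanishes. -/
theorem aemeasurable_of_continuousOn_of_ae {X E : Type*} [TopologicalSpace X] [MeasurableSpace X]
    [OpensMeasurableSpace X] [TopologicalSpace E] [MeasurableSpace E] [BorelSpace E] {f : X → E}
    {S : Set X} (hf : ContinuousOn f S) (hS : MeasurableSet S) {μ : Measure X}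
    (h : ∀ᵐ x ∂μ, x ∈ S) : AEMeasurable f μ := by
  rw [← Measure.restrict_eq_self_of_ae_mem h]
  exact hf.aemeasurable hS

theorem aemeasurable_integerLine {β : ℝ} (hβ : 0 < β) :
    AEMeasurable (fun u : unitInterval => (integerLine √(β * u)).toClass) volume := by
  refine aemeasurable_of_continuousOn_of_ae (S := {0}ᶜ) ?_
    (measurableSet_singleton _).compl (Measure.ae_ne _ _)
  refine continuousOn_integerLine.comp (by fun_prop) fun u hu => ?_
  exact (Real.sqrt_pos.2 (mul_pos hβ (unitInterval.pos_iff_ne_zero.2 hu))).ne'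

theorem continuousOn_tridiagRootedGraph_prod (n : ℕ) :
    ContinuousOn (fun p : ((Fin (n + 1) → ℝ) × (Fin n → ℝ)) × Fin (n + 1) =>
      (tridiagRootedGraph p.1 p.2).toClass) {p | ∀ j, p.1.2 j ≠ 0} := by
  refine continuousOn_toClass fun p hp r ε hε => ?_
  have h₁ : ∀ᶠ q : ((Fin (n + 1) → ℝ) × (Fin n → ℝ)) × Fin (n + 1) in 𝓝 p, q.2 = p.2 :=
    (continuous_snd.tendsto p).eventually
      ((isOpen_discrete {p.2}).mem_nhds (Set.mem_singleton _))
  have h₂ : ∀ᶠ q : ((Fin (n + 1) → ℝ) × (Fin n → ℝ)) × Fin (n + 1) in 𝓝 p,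
      q.1 ∈ Metric.ball p.1 ε :=
    (continuous_fst.tendsto p).eventually (Metric.ball_mem_nhds _ hε)
  filter_upwards [self_mem_nhdsWithin, mem_nhdsWithin_of_mem_nhds h₁,
    mem_nhdsWithin_of_mem_nhds h₂] with q hq hq₁ hq₂
  rw [hq₁]
  exact tridiagRootedGraph_locallyClose hp hq _ r (by rwa [dist_comm])

theorem aemeasurable_tridiagRootedGraph {β : ℝ} (hβ : 0 < β) {Ω : Type*} [MeasurableSpace Ω]
    {P : Measure Ω} [IsProbabilityMeasure P] {n : ℕ} {X : Ω → (Fin (n + 1) → ℝ) × (Fin n → ℝ)}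
    (hX : HasLaw X (hermiteEntriesLaw β n) P) (ν : Measure (Fin (n + 1))) [IsProbabilityMeasure ν] :
    AEMeasurable (fun p : Ω × Fin (n + 1) => (tridiagRootedGraph (X p.1) p.2).toClass)
      (P.prod ν) := by
  have hφ : AEMeasurable (fun p : Ω × Fin (n + 1) => (X p.1, p.2)) (P.prod ν) :=
    (hX.aemeasurable.comp_quasiMeasurePreserving Measure.quasiMeasurePreserving_fst).prodMk
      measurable_snd.aemeasurable
  have hS : MeasurableSet {p : ((Fin (n + 1) → ℝ) × (Fin n → ℝ)) × Fin (n + 1) |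
      ∀ j, p.1.2 j ≠ 0} := by
    rw [Set.ofPred_forall]
    exact MeasurableSet.iInter fun j => (measurableSet_singleton (0 : ℝ)).compl.preimage
      (by fun_prop)
  refine AEMeasurable.comp_aemeasurable (g := fun p : ((Fin (n + 1) → ℝ) × (Fin n → ℝ)) ×
    Fin (n + 1) => (tridiagRootedGraph p.1 p.2).toClass) ?_ hφ
  refine aemeasurable_of_continuousOn_of_ae (continuousOn_tridiagRootedGraph_prod n) hS ?_
  refine (ae_map_iff hφ hS).2 ?_
  have hpos : ∀ᵐ ω ∂P, ∀ j, (X ω).2 j ≠ 0 := by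
    have h := ae_pos_edge hβ n
    rw [← hX.map_eq] at h
    filter_upwards [ae_of_ae_map hX.aemeasurable h] with ω hω j using (hω j).ne'
  exact Measure.quasiMeasurePreserving_fst.ae hpos

/-- The exceptional set depends only on positivity of the edges and on the defects, so one null set
serves all test functions, without a countable determining family. -/
theorem ae_tendsto_average_tridiagRootedGraph {β : ℝ} (hβ : 0 < β) {Ω : Type*} [MeasurableSpace Ω]
    {P : Measure Ω} {X : ∀ n : ℕ, Ω → (Fin (n + 1) → ℝ) × (Fin n → ℝ)}
    (hX : ∀ n, HasLaw (X n) (hermiteEntriesLaw β n) P) :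
    ∀ᵐ ω ∂P, ∀ f : RootedGraphClass → ℝ, Continuous f → ∀ M, (∀ y, |f y| ≤ M) →
      Tendsto (fun n => ∫ o, f (tridiagRootedGraph (X n ω) o).toClass
          ∂(uniformOn (Set.univ : Set (Fin (n + 1)))))
        atTop (𝓝 (∫ u : unitInterval, f (integerLine √(β * u)).toClass)) := by
  have hpos : ∀ᵐ ω ∂P, ∀ n j, 0 < (X n ω).2 j := ae_all_iff.2 fun n => by
    have h := ae_pos_edge hβ n
    rw [← (hX n).map_eq] at h
    exact ae_of_ae_map (hX n).aemeasurable h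
  filter_upwards [hpos, ae_tendsto_tridiagDefect hβ hX] with ω hω hD f hf M hM
  simp only [integral_uniformOn_univ_fin]
  exact tendsto_average_tridiagRootedGraph hβ hω hD hf hM

theorem quenched_benjaminiSchrammConverges {β : ℝ} (hβ : 0 < β) {Ω : Type*} [MeasurableSpace Ω]
    {P : Measure Ω} {X : ∀ n : ℕ, Ω → (Fin (n + 1) → ℝ) × (Fin n → ℝ)}
    (hX : ∀ n, HasLaw (X n) (hermiteEntriesLaw β n) P) :
    ∀ᵐ ω ∂P, BenjaminiSchrammConverges
      (fun n (o : Fin (n + 1)) => tridiagRootedGraph (X n ω) o)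
      (fun n => uniformOn (Set.univ : Set (Fin (n + 1))))
      (fun u : unitInterval => integerLine √(β * u)) volume := by
  filter_upwards [ae_tendsto_average_tridiagRootedGraph hβ hX] with ω hω
  exact tendstoInDistribution_of_forall_integral
    (fun n => (measurable_of_finite _).aemeasurable) (aemeasurable_integerLine hβ) hω

/-- By Fubini the expectation is the mean over `ω` of the averages over the root; these converge
almost surely and are bounded by `M`, so dominated convergence applies. -/
theorem annealed_benjaminiSchrammConverges {β : ℝ} (hβ : 0 < β) {Ω : Type*} [MeasurableSpace Ω]
    {P : Measure Ω} [IsProbabilityMeasure P]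
    {X : ∀ n : ℕ, Ω → (Fin (n + 1) → ℝ) × (Fin n → ℝ)}
    (hX : ∀ n, HasLaw (X n) (hermiteEntriesLaw β n) P) :
    BenjaminiSchrammConverges
      (fun n (p : Ω × Fin (n + 1)) => tridiagRootedGraph (X n p.1) p.2)
      (fun n => P.prod (uniformOn (Set.univ : Set (Fin (n + 1)))))
      (fun u : unitInterval => integerLine √(β * u)) volume := by
  have hmeas := fun n => aemeasurable_tridiagRootedGraph hβ (hX n)
    (uniformOn (Set.univ : Set (Fin (n + 1))))
  refine tendstoInDistribution_of_forall_integral hmeas (aemeasurable_integerLine hβ) ?_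
  intro f hf M hM
  have hint : ∀ n, Integrable (fun p : Ω × Fin (n + 1) =>
      f (tridiagRootedGraph (X n p.1) p.2).toClass)
      (P.prod (uniformOn (Set.univ : Set (Fin (n + 1))))) := fun n =>
    Integrable.of_bound (hf.measurable.comp_aemeasurable (hmeas n)).aestronglyMeasurable M
      (Eventually.of_forall fun p => hM _)
  have h := tendsto_integral_of_dominated_convergence (fun _ : Ω => M)
    (fun n => (hint n).integral_prod_left.aestronglyMeasurable) (integrable_const M)
    (fun n => Eventually.of_forall fun ω => ?_)
    ((ae_tendsto_average_tridiagRootedGraph hβ hX).mono fun ω hω => hω f hf M hM)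
  · simp only [integral_const, probReal_univ, one_smul] at h
    exact h.congr fun n => (integral_prod _ (hint n)).symm
  · have h := norm_integral_le_of_norm_le_const
      (μ := uniformOn (Set.univ : Set (Fin (n + 1))))
      (f := fun o => f (tridiagRootedGraph (X n ω) o).toClass) (C := M)
      (Eventually.of_forall fun o => hM _)
    simpa only [probReal_univ, mul_one] using h

/-! ## Projection-valued measures of multiplication operators -/

section Multiplication

variable {α : Type*} [MeasurableSpace α] {μ : Measure α}

open Classical in
/-- Multiplication by an essentially bounded function `g` on `L²`. -/
noncomputable def mulL2 (μ : Measure α) (g : α → ℂ) : Lp ℂ 2 μ →L[ℂ] Lp ℂ 2 μ :=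
  if h : MemLp g ∞ μ then (ContinuousLinearMap.mul ℂ ℂ).holderL μ ∞ 2 2 h.toLp else 0

theorem coeFn_mulL2 {g : α → ℂ} (hg : MemLp g ∞ μ) (f : Lp ℂ 2 μ) :
    mulL2 μ g f =ᵐ[μ] fun x => g x * f x := by
  rw [mulL2, dif_pos hg]
  filter_upwards [(ContinuousLinearMap.mul ℂ ℂ).coeFn_holder (r := 2) hg.toLp f, hg.coeFn_toLp]
    with x h₁ h₂
  rw [ContinuousLinearMap.holderL_apply_apply, h₁, h₂]
  rfl

theorem inner_mulL2_self {g : α → ℝ} (hg : MemLp (fun x => (g x : ℂ)) ∞ μ) (f : Lp ℂ 2 μ) :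
    ⟪mulL2 μ (fun x => (g x : ℂ)) f, f⟫_ℂ = ((∫ x, g x * ‖f x‖ ^ 2 ∂μ : ℝ) : ℂ) := by
  rw [L2.inner_def, ← integral_complex_ofReal]
  refine integral_congr_ae ?_
  filter_upwards [coeFn_mulL2 hg f] with x hx
  rw [hx, RCLike.inner_apply, map_mul, Complex.conj_ofReal]
  push_cast
  rw [mul_left_comm, Complex.mul_conj, Complex.normSq_eq_norm_sq]
  push_cast
  rfl

theorem isSelfAdjoint_mulL2 {g : α → ℝ} (hg : MemLp (fun x => (g x : ℂ)) ∞ μ) :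
    IsSelfAdjoint (mulL2 μ fun x => (g x : ℂ)) := by
  rw [ContinuousLinearMap.isSelfAdjoint_iff_isSymmetric]
  intro f h
  change ⟪mulL2 μ _ f, h⟫_ℂ = ⟪f, mulL2 μ _ h⟫_ℂ
  rw [L2.inner_def, L2.inner_def]
  refine integral_congr_ae ?_
  filter_upwards [coeFn_mulL2 hg f, coeFn_mulL2 hg h] with x h₁ h₂
  rw [h₁, h₂, RCLike.inner_apply, RCLike.inner_apply, map_mul, Complex.conj_ofReal]
  ring

variable {φ : α → ℝ}

/-- The indicator function of `φ ∈ X`. -/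
noncomputable def preimageIndicator (φ : α → ℝ) (X : Set ℝ) (x : α) : ℝ :=
  X.indicator (fun _ => 1) (φ x)

theorem memLp_preimageIndicator (hφ : Measurable φ) {X : Set ℝ} (hX : MeasurableSet X) :
    MemLp (fun x => (preimageIndicator φ X x : ℂ)) ∞ μ := by
  refine memLp_top_of_bound (C := 1) ?_ (Eventually.of_forall fun x => ?_)
  · exact (Complex.measurable_ofReal.comp
      ((measurable_const.indicator hX).comp hφ)).aestronglyMeasurable
  · rw [Complex.norm_real]
    refine (norm_indicator_le_norm_self _ _).trans ?_
    simp

/-- The spectral distribution of `f ∈ L²` for the operator of multiplication by `φ`. -/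
noncomputable def spectralDistribution (φ : α → ℝ) (f : Lp ℂ 2 μ) : Measure ℝ :=
  (μ.withDensity fun x => ‖f x‖ₑ ^ 2).map φ

theorem integrable_norm_sq (f : Lp ℂ 2 μ) : Integrable (fun x => ‖f x‖ ^ 2) μ :=
  (Lp.memLp f).integrable_norm_pow (by norm_num)

theorem aemeasurable_enorm_sq (f : Lp ℂ 2 μ) : AEMeasurable (fun x => ‖f x‖ₑ ^ 2) μ :=
  (Lp.aestronglyMeasurable f).enorm.pow_const 2

theorem enorm_sq_eq_ofReal (z : ℂ) : ‖z‖ₑ ^ 2 = ENNReal.ofReal (‖z‖ ^ 2) := by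
  rw [← ofReal_norm, ENNReal.ofReal_pow (norm_nonneg _)]

instance isFiniteMeasure_spectralDistribution (φ : α → ℝ) (f : Lp ℂ 2 μ) :
    IsFiniteMeasure (spectralDistribution φ f) := by
  have : IsFiniteMeasure (μ.withDensity fun x => ‖f x‖ₑ ^ 2) := by
    refine isFiniteMeasure_withDensity ?_
    simp only [enorm_sq_eq_ofReal]
    exact (integrable_norm_sq f).lintegral_lt_top.ne
  unfold spectralDistribution
  infer_instance

theorem integral_preimageIndicator_mul (hφ : Measurable φ) {X : Set ℝ} (hX : MeasurableSet X)
    (f : Lp ℂ 2 μ) :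
    ∫ x, preimageIndicator φ X x * ‖f x‖ ^ 2 ∂μ = (spectralDistribution φ f).real X := by
  have h : ∀ x, preimageIndicator φ X x * ‖f x‖ ^ 2 =
      (φ ⁻¹' X).indicator (fun x => ‖f x‖ ^ 2) x := fun x => by
    by_cases hx : φ x ∈ X
    · simp [preimageIndicator, hx]
    · simp [preimageIndicator, hx]
  simp only [h]
  rw [integral_indicator (hφ hX), measureReal_def, spectralDistribution, Measure.map_apply hφ hX,
    withDensity_apply _ (hφ hX),
    integral_eq_lintegral_of_nonneg_ae (Eventually.of_forall fun x => by positivity)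
      (integrable_norm_sq f).aestronglyMeasurable.restrict]
  simp only [enorm_sq_eq_ofReal]

theorem mulL2_preimageIndicator_idempotent (hφ : Measurable φ) {X : Set ℝ}
    (hX : MeasurableSet X) :
    IsIdempotentElem (mulL2 μ fun x => (preimageIndicator φ X x : ℂ)) := by
  refine ContinuousLinearMap.ext fun f => Lp.ext ?_
  have hg := memLp_preimageIndicator (μ := μ) hφ hX
  filter_upwards [coeFn_mulL2 hg f, coeFn_mulL2 hg (mulL2 μ _ f)] with x h₁ h₂
  rw [mul_apply_eq_comp, h₂, h₁]
  by_cases hx : φ x ∈ X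
  · simp [preimageIndicator, hx]
  · simp [preimageIndicator, hx]

theorem mulL2_preimageIndicator_union (hφ : Measurable φ) {X Y : Set ℝ} (hX : MeasurableSet X)
    (hY : MeasurableSet Y) (hXY : Disjoint X Y) (f : Lp ℂ 2 μ) :
    mulL2 μ (fun x => (preimageIndicator φ (X ∪ Y) x : ℂ)) f =
      mulL2 μ (fun x => (preimageIndicator φ X x : ℂ)) f +
      mulL2 μ (fun x => (preimageIndicator φ Y x : ℂ)) f := by
  refine Lp.ext ?_
  filter_upwards [coeFn_mulL2 (memLp_preimageIndicator (μ := μ) hφ (hX.union hY)) f,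
    coeFn_mulL2 (memLp_preimageIndicator (μ := μ) hφ hX) f,
    coeFn_mulL2 (memLp_preimageIndicator (μ := μ) hφ hY) f, Lp.coeFn_add
      (mulL2 μ (fun x => (preimageIndicator φ X x : ℂ)) f)
      (mulL2 μ (fun x => (preimageIndicator φ Y x : ℂ)) f)] with x h₁ h₂ h₃ h₄
  rw [h₁, h₄, Pi.add_apply, h₂, h₃, ← add_mul]
  congr 1
  unfold preimageIndicator
  rw [Set.indicator_union_of_disjoint hXY]
  push_cast
  rfl

/-- A projection satisfies `‖Pf‖² = ⟪Pf, f⟫`. This reduces strong convergence to convergence of a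
scalar measure. -/
theorem norm_sq_mulL2_preimageIndicator (hφ : Measurable φ) {X : Set ℝ} (hX : MeasurableSet X)
    (f : Lp ℂ 2 μ) :
    ‖mulL2 μ (fun x => (preimageIndicator φ X x : ℂ)) f‖ ^ 2 =
      (spectralDistribution φ f).real X := by
  have hg := memLp_preimageIndicator (μ := μ) hφ hX
  rw [← integral_preimageIndicator_mul hφ hX, ← Complex.ofReal_inj, ← inner_mulL2_self hg]
  have h := inner_self_eq_norm_sq_to_K (𝕜 := ℂ)
    (mulL2 μ (fun x => (preimageIndicator φ X x : ℂ)) f)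
  have hs := (ContinuousLinearMap.isSelfAdjoint_iff_isSymmetric.1 (isSelfAdjoint_mulL2 hg)) f
    (mulL2 μ (fun x => (preimageIndicator φ X x : ℂ)) f)
  have hs' := (ContinuousLinearMap.isSelfAdjoint_iff_isSymmetric.1 (isSelfAdjoint_mulL2 hg))
    (mulL2 μ (fun x => (preimageIndicator φ X x : ℂ)) f) f
  have hi : mulL2 μ (fun x => (preimageIndicator φ X x : ℂ))
      (mulL2 μ (fun x => (preimageIndicator φ X x : ℂ)) f) =
      mulL2 μ (fun x => (preimageIndicator φ X x : ℂ)) f :=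
    congrArg (fun T => T f) (mulL2_preimageIndicator_idempotent (μ := μ) hφ hX)
  simp only [ContinuousLinearMap.coe_coe, hi] at hs hs'
  rw [hs', h]
  push_cast
  rfl

/-- The remainder after finitely many sets is the projection for the remaining union, and its
squared norm is a tail of the finite measure `ν`. -/
theorem hasSum_mulL2_preimageIndicator (hφ : Measurable φ) {X : ℕ → Set ℝ}
    (hX : ∀ i, MeasurableSet (X i)) (hd : Pairwise (Function.onFun Disjoint X)) (f : Lp ℂ 2 μ) :
    HasSum (fun i => mulL2 μ (fun x => (preimageIndicator φ (X i) x : ℂ)) f)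
      (mulL2 μ (fun x => (preimageIndicator φ (⋃ i, X i) x : ℂ)) f) := by
  set P : Set ℝ → Lp ℂ 2 μ := fun Y => mulL2 μ (fun x => (preimageIndicator φ Y x : ℂ)) f
  set ν := spectralDistribution φ f
  have hfin : ∀ s : Finset ℕ, P (⋃ i ∈ s, X i) = ∑ i ∈ s, P (X i) := by
    intro s
    induction s using Finset.induction_on with
    | empty =>
      have h := norm_sq_mulL2_preimageIndicator hφ MeasurableSet.empty f
      rw [measureReal_empty, sq_eq_zero_iff, norm_eq_zero] at h
      simpa using h
    | insert a s ha ih =>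
      rw [Finset.set_biUnion_insert, Finset.sum_insert ha, ← ih]
      refine mulL2_preimageIndicator_union hφ (hX a) (s.measurableSet_biUnion fun i _ => hX i) ?_ f
      rw [Set.disjoint_iUnion₂_right]
      exact fun i hi => hd (by rintro rfl; exact ha hi)
  have hsub : ∀ s : Finset ℕ, ‖P (⋃ i, X i) - ∑ i ∈ s, P (X i)‖ ^ 2 =
      ν.real (⋃ i, X i) - ∑ i ∈ s, ν.real (X i) := by
    intro s
    have hms : MeasurableSet (⋃ i ∈ s, X i) := s.measurableSet_biUnion fun i _ => hX i
    have hm : MeasurableSet ((⋃ i, X i) \ ⋃ i ∈ s, X i) := (MeasurableSet.iUnion hX).diff hms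
    have hss : (⋃ i ∈ s, X i) ⊆ ⋃ i, X i := Set.iUnion₂_subset fun i _ => Set.subset_iUnion X i
    have h := mulL2_preimageIndicator_union (μ := μ) hφ hms hm Set.disjoint_sdiff_right f
    rw [Set.union_sdiff_cancel hss] at h
    have h' : P (⋃ i, X i) - ∑ i ∈ s, P (X i) = P ((⋃ i, X i) \ ⋃ i ∈ s, X i) := by
      rw [← hfin s, sub_eq_iff_eq_add']
      exact h
    rw [h', norm_sq_mulL2_preimageIndicator hφ hm, measureReal_sdiff hss hms,
      measureReal_biUnion_finset (fun i _ j _ hij => hd hij) fun i _ => hX i]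
  have hν : HasSum (fun i => ν.real (X i)) (ν.real (⋃ i, X i)) := by
    have hne : ∑' i, ν (X i) ≠ ∞ := by
      rw [← measure_iUnion hd hX]
      exact measure_ne_top _ _
    have h := ENNReal.hasSum_toReal hne
    rwa [← ENNReal.tsum_toReal_eq fun i => measure_ne_top _ _, ← measure_iUnion hd hX] at h
  rw [HasSum, tendsto_iff_norm_sub_tendsto_zero]
  have h0 : Tendsto (fun s : Finset ℕ => ν.real (⋃ i, X i) - ∑ i ∈ s, ν.real (X i)) atTop
      (𝓝 0) := by
    have h : Tendsto (fun s : Finset ℕ => ∑ i ∈ s, ν.real (X i)) atTop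
      (𝓝 (ν.real (⋃ i, X i))) := hν
    simpa using h.const_sub (ν.real (⋃ i, X i))
  have h1 := (Real.continuous_sqrt.tendsto 0).comp h0
  rw [Real.sqrt_zero] at h1
  refine h1.congr fun s => ?_
  rw [Function.comp, ← hsub, Real.sqrt_sq (norm_nonneg _), norm_sub_rev]

/-- The projection-valued measure of multiplication by `φ` on `L²`. -/
noncomputable def mulL2PVM (μ : Measure α) (hφ : Measurable φ) :
    ProjectionValuedMeasure (Lp ℂ 2 μ) where
  proj X := mulL2 μ fun x => (preimageIndicator φ X x : ℂ)
  isStarProjection X hX := ⟨mulL2_preimageIndicator_idempotent hφ hX,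
    isSelfAdjoint_mulL2 (memLp_preimageIndicator hφ hX)⟩
  univ := by
    refine ContinuousLinearMap.ext fun f => Lp.ext ?_
    filter_upwards [coeFn_mulL2 (memLp_preimageIndicator (μ := μ) hφ MeasurableSet.univ) f]
      with x hx
    rw [hx]
    simp [preimageIndicator]
  hasSum_iUnion X hX hd f := hasSum_mulL2_preimageIndicator hφ hX hd f

theorem ProjectionValuedMeasure.measure_apply {H : Type*} [NormedAddCommGroup H]
    [InnerProductSpace ℂ H] [CompleteSpace H] (P : ProjectionValuedMeasure H) (ψ : H) {X : Set ℝ}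
    (hX : MeasurableSet X) : P.measure ψ X = ENNReal.ofReal (⟪P.proj X ψ, ψ⟫_ℂ).re :=
  Measure.ofMeasurable_apply X hX

theorem mulL2PVM_measure (hφ : Measurable φ) (f : Lp ℂ 2 μ) :
    (mulL2PVM μ hφ).measure f = spectralDistribution φ f := by
  refine Measure.ext fun X hX => ?_
  rw [ProjectionValuedMeasure.measure_apply _ _ hX]
  change ENNReal.ofReal (⟪mulL2 μ (fun x => (preimageIndicator φ X x : ℂ)) f, f⟫_ℂ).re = _
  rw [inner_mulL2_self (memLp_preimageIndicator hφ hX), Complex.ofReal_re,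
    integral_preimageIndicator_mul hφ hX, ofReal_measureReal]

/-- Both sides equal `∫ φ ‖f‖²`, by change of variables. The bound on `φ` gives integrability and
excludes the default value `0` of `mulL2`. -/
theorem mulL2PVM_represents (hφ : Measurable φ) {C : ℝ} (hC : ∀ x, |φ x| ≤ C) :
    (mulL2PVM μ hφ).Represents (mulL2 μ fun x => (φ x : ℂ)) := by
  intro f
  have hg : MemLp (fun x => (φ x : ℂ)) ∞ μ :=
    memLp_top_of_bound (Complex.measurable_ofReal.comp hφ).aestronglyMeasurable C
      (Eventually.of_forall fun x => by simpa using hC x)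
  rw [mulL2PVM_measure, inner_mulL2_self hg]
  constructor
  · refine Integrable.of_bound aestronglyMeasurable_id C ?_
    rw [spectralDistribution]
    refine (ae_map_iff hφ.aemeasurable ?_).2 (Eventually.of_forall hC)
    exact measurableSet_le measurable_norm measurable_const
  · rw [spectralDistribution, integral_map hφ.aemeasurable (f := fun y => y)
      aestronglyMeasurable_id, integral_withDensity_eq_integral_toReal_smul₀ (aemeasurable_enorm_sq f)
        (Eventually.of_forall fun x => by simp)]
    simp [mul_comm]

end Multiplication

/-- Transport of a projection-valued measure along a unitary equivalence. -/
noncomputable def ProjectionValuedMeasure.map {H K : Type*} [NormedAddCommGroup H]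
    [InnerProductSpace ℂ H] [CompleteSpace H] [NormedAddCommGroup K] [InnerProductSpace ℂ K]
    [CompleteSpace K] (P : ProjectionValuedMeasure H) (U : H ≃ₗᵢ[ℂ] K) :
    ProjectionValuedMeasure K where
  proj X := U.conjStarAlgEquiv (P.proj X)
  isStarProjection X hX := (P.isStarProjection X hX).map U.conjStarAlgEquiv
  univ := by rw [P.univ, map_one]
  hasSum_iUnion X hX hd ψ := by
    have h := P.hasSum_iUnion X hX hd (U.symm ψ)
    exact h.mapL (U.toContinuousLinearEquiv : H →L[ℂ] K)

section Map

variable {H K : Type*} [NormedAddCommGroup H] [InnerProductSpace ℂ H] [CompleteSpace H]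
  [NormedAddCommGroup K] [InnerProductSpace ℂ K] [CompleteSpace K]

theorem ProjectionValuedMeasure.map_measure (P : ProjectionValuedMeasure H) (U : H ≃ₗᵢ[ℂ] K)
    (ψ : K) : (P.map U).measure ψ = P.measure (U.symm ψ) := by
  refine Measure.ext fun X hX => ?_
  rw [measure_apply _ _ hX, measure_apply _ _ hX]
  change ENNReal.ofReal (⟪U (P.proj X (U.symm ψ)), ψ⟫_ℂ).re = _
  rw [← U.symm.inner_map_map, U.symm_apply_apply]

theorem ProjectionValuedMeasure.Represents.map {P : ProjectionValuedMeasure H} {A : H →L[ℂ] H}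
    (h : P.Represents A) (U : H ≃ₗᵢ[ℂ] K) : (P.map U).Represents (U.conjStarAlgEquiv A) := by
  intro ψ
  rw [map_measure, LinearIsometryEquiv.conjStarAlgEquiv_apply_apply, ← U.symm.inner_map_map,
    U.symm_apply_apply]
  exact h (U.symm ψ)

end Map

/-! ## The spectral measure of the integer line -/

instance fact_two_pi_pos : Fact (0 < 2 * Real.pi) := ⟨Real.two_pi_pos⟩

/-- The symbol `2 c cos θ` of the adjacency operator of the integer line. -/
noncomputable def lineSymbol (c : ℝ) (t : AddCircle (2 * Real.pi)) : ℝ :=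
  2 * c * (fourier 1 t).re

theorem continuous_lineSymbol : Continuous fun p : ℝ × AddCircle (2 * Real.pi) =>
    lineSymbol p.1 p.2 :=
  (continuous_const.mul continuous_fst).mul
    (Complex.continuous_re.comp ((fourier 1).continuous.comp continuous_snd))

theorem measurable_lineSymbol (c : ℝ) : Measurable (lineSymbol c) :=
  (continuous_const.mul (Complex.continuous_re.comp (fourier 1).continuous)).measurable

theorem ofReal_lineSymbol (c : ℝ) (t : AddCircle (2 * Real.pi)) :
    (lineSymbol c t : ℂ) = c * (fourier 1 t + fourier (-1) t) := by
  rw [fourier_neg, Complex.add_conj, lineSymbol]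
  push_cast
  ring

theorem lineSymbol_coe (c θ : ℝ) :
    lineSymbol c (θ : AddCircle (2 * Real.pi)) = 2 * c * Real.cos θ := by
  have h : (2 * Real.pi * Complex.I * (1 : ℤ) * θ / (2 * Real.pi : ℝ) : ℂ) = θ * Complex.I := by
    have : (Real.pi : ℂ) ≠ 0 := Complex.ofReal_ne_zero.2 Real.pi_ne_zero
    push_cast
    field_simp
  rw [lineSymbol, fourier_coe_apply, h, Complex.exp_ofReal_mul_I_re]

theorem abs_lineSymbol_le (c : ℝ) (t : AddCircle (2 * Real.pi)) :
    |lineSymbol c t| ≤ |2 * c| := by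
  rw [lineSymbol, abs_mul]
  refine mul_le_of_le_one_right (abs_nonneg _) ((Complex.abs_re_le_norm _).trans ?_)
  rw [fourier_apply, Circle.norm_coe]

/-- The adjacency operator of the integer line, as the Fourier transform of a multiplication
operator. -/
noncomputable def lineOperator (c : ℝ) :
    lp (fun _ : ℤ => ℂ) 2 →L[ℂ] lp (fun _ : ℤ => ℂ) 2 :=
  (fourierBasis (T := 2 * Real.pi)).repr.conjStarAlgEquiv
    (mulL2 AddCircle.haarAddCircle fun t => (lineSymbol c t : ℂ))

theorem memLp_lineSymbol (c : ℝ) :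
    MemLp (fun t => (lineSymbol c t : ℂ)) ∞ (AddCircle.haarAddCircle (T := 2 * Real.pi)) :=
  memLp_top_of_bound (Complex.measurable_ofReal.comp (measurable_lineSymbol c)).aestronglyMeasurable
    |2 * c| (Eventually.of_forall fun x => by simpa using abs_lineSymbol_le c x)

/-- The symbol is `c (e^{iθ} + e^{-iθ})`, and multiplication by `e^{±iθ}` shifts the Fourier
coefficients by one. -/
theorem lineOperator_apply (c : ℝ) (f : lp (fun _ : ℤ => ℂ) 2) (v : ℤ) :
    lineOperator c f v = c * (f (v - 1) + f (v + 1)) := by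
  set g := (fourierBasis (T := 2 * Real.pi)).repr.symm f with hg
  have hf : ∀ w, f w = fourierCoeff g w := fun w => by
    rw [← fourierBasis_repr, hg, LinearIsometryEquiv.apply_symm_apply]
  have hgi : Integrable g (AddCircle.haarAddCircle (T := 2 * Real.pi)) :=
    (Lp.memLp g).integrable (by norm_num)
  have hi := fun w : ℤ => hgi.fourier_smul w
  rw [lineOperator, LinearIsometryEquiv.conjStarAlgEquiv_apply_apply, fourierBasis_repr, hf, hf,
    fourierCoeff, fourierCoeff, fourierCoeff, ← integral_add (hi _) (hi _), ← integral_const_mul]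
  refine integral_congr_ae ?_
  filter_upwards [coeFn_mulL2 (memLp_lineSymbol c) g] with t ht
  simp only [smul_eq_mul]
  rw [ht, ofReal_lineSymbol, show -(v - 1) = -v + 1 by ring, show -(v + 1) = -v + -1 by ring,
    fourier_add, fourier_add]
  ring

theorem lineOperator_apply_eq_finsum (c : ℝ) (f : lp (fun _ : ℤ => ℂ) 2) (v : ℤ) :
    lineOperator c f v =
      ∑ᶠ u : ℤ, ((if v + 1 = u ∨ u + 1 = v then c else 0 : ℝ) : ℂ) * f u := by
  rw [lineOperator_apply]
  rw [finsum_eq_sum_of_support_subset (s := {v - 1, v + 1}), Finset.sum_pair (by omega),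
    if_pos (by omega), if_pos (by omega), mul_add]
  intro u hu
  rw [Function.mem_support] at hu
  by_contra h
  refine hu ?_
  rw [if_neg, Complex.ofReal_zero, zero_mul]
  simp only [Finset.coe_insert, Finset.coe_singleton, Set.mem_insert_iff, Set.mem_singleton_iff]
    at h
  omega

theorem isAdjacencyOperator_lineOperator (c : ℝ) :
    (integerLine c).toGraph.IsAdjacencyOperator (lineOperator c) :=
  fun f v => lineOperator_apply_eq_finsum c f v

/-- The projection-valued measure of the adjacency operator of the integer line. -/
noncomputable def linePVM (c : ℝ) : ProjectionValuedMeasure (lp (fun _ : ℤ => ℂ) 2) :=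
  (mulL2PVM AddCircle.haarAddCircle (measurable_lineSymbol c)).map
    (fourierBasis (T := 2 * Real.pi)).repr

theorem linePVM_represents (c : ℝ) : (linePVM c).Represents (lineOperator c) :=
  (mulL2PVM_represents (measurable_lineSymbol c) (abs_lineSymbol_le c)).map _

/-- The indicator of the root corresponds to the constant function `1`, whose squared modulus leaves
Haar measure unchanged. -/
theorem linePVM_measure_single [DecidableEq ℤ] (c : ℝ) :
    (linePVM c).measure (lp.single 2 (0 : ℤ) (1 : ℂ)) =
      AddCircle.haarAddCircle.map (lineSymbol c) := by
  rw [linePVM, ProjectionValuedMeasure.map_measure, HilbertBasis.repr_symm_single,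
    mulL2PVM_measure, spectralDistribution]
  congr 1
  rw [coe_fourierBasis]
  have h : (fun t => ‖(fourierLp (T := 2 * Real.pi) 2 0) t‖ₑ ^ 2)
      =ᵐ[AddCircle.haarAddCircle] 1 := by
    filter_upwards [coeFn_fourierLp (T := 2 * Real.pi) 2 0] with t ht
    rw [ht]
    simp
  rw [withDensity_congr_ae h, withDensity_one]

theorem isSpectralMeasure_integerLine (c : ℝ) :
    (integerLine c).IsSpectralMeasure (AddCircle.haarAddCircle.map (lineSymbol c)) := by
  classical
  exact ⟨lineOperator c, isAdjacencyOperator_lineOperator c, linePVM c, linePVM_represents c,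
    (@linePVM_measure_single (fun _ _ => Classical.propDecidable _) c).symm⟩

/-! ## The expected spectral measure -/

/-- The open interval is chosen because it is the angular range of `polarCoord.target`. -/
theorem lintegral_haarAddCircle_lineSymbol (c : ℝ) (f : ℝ → ℝ≥0∞) :
    ∫⁻ t, f (lineSymbol c t) ∂(AddCircle.haarAddCircle (T := 2 * Real.pi)) =
      (ENNReal.ofReal (2 * Real.pi))⁻¹ *
        ∫⁻ θ in Set.Ioo (-Real.pi) Real.pi, f (2 * c * Real.cos θ) := by
  have h := AddCircle.lintegral_preimage (2 * Real.pi) (-Real.pi) fun t => f (lineSymbol c t)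
  rw [show -Real.pi + 2 * Real.pi = Real.pi by ring, AddCircle.volume_eq_smul_haarAddCircle,
    lintegral_smul_measure] at h
  simp only [lineSymbol_coe] at h
  rw [setLIntegral_congr Ioo_ae_eq_Ioc, h, smul_eq_mul, ← mul_assoc, ENNReal.inv_mul_cancel,
    one_mul]
  · simpa using Real.pi_pos
  · exact ENNReal.ofReal_ne_top

theorem measurable_map_lineSymbol (β : ℝ) : Measurable fun u : unitInterval =>
    (AddCircle.haarAddCircle (T := 2 * Real.pi)).map (lineSymbol √(β * u)) := by
  refine Measure.measurable_of_measurable_coe _ fun X hX => ?_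
  simp only [Measure.map_apply (measurable_lineSymbol _) hX]
  have hc : Continuous fun p : unitInterval × AddCircle (2 * Real.pi) =>
      lineSymbol √(β * p.1) p.2 :=
    continuous_lineSymbol.comp (by fun_prop : Continuous fun p : unitInterval ×
      AddCircle (2 * Real.pi) => (√(β * p.1), p.2))
  exact measurable_measure_prodMk_left (hX.preimage hc.measurable)

/-- Substitution `u = r² / (4β)`: the density `r / (2β)` is that of the radius of a uniform point in
the disc of radius `2√β`. -/
theorem lintegral_Ioo_eq_lintegral_sq {β : ℝ} (hβ : 0 < β) (g : ℝ → ℝ≥0∞) :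
    ∫⁻ u in Set.Ioo (0 : ℝ) 1, g (2 * √(β * u)) =
      ∫⁻ r in Set.Ioo 0 (2 * √β), ENNReal.ofReal (r / (2 * β)) * g r := by
  have hR : 0 < 2 * √β := by positivity
  have hsq : (2 * √β) ^ 2 = 4 * β := by rw [mul_pow, Real.sq_sqrt hβ.le]; norm_num
  have himg : (fun r : ℝ => r ^ 2 / (4 * β)) '' Set.Ioo 0 (2 * √β) = Set.Ioo 0 1 := by
    ext u
    constructor
    · rintro ⟨r, ⟨h0, h1⟩, rfl⟩
      refine ⟨by positivity, ?_⟩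
      simp only
      rw [div_lt_one (by positivity), ← hsq]
      exact pow_lt_pow_left₀ h1 h0.le two_ne_zero
    · rintro ⟨h0, h1⟩
      refine ⟨2 * √(β * u), ⟨by positivity, ?_⟩, ?_⟩
      · have : √(β * u) < √β := Real.sqrt_lt_sqrt (by positivity) (by nlinarith)
        linarith
      · simp only
        rw [mul_pow, Real.sq_sqrt (by positivity)]
        field_simp
        norm_num
  have hinj : Set.InjOn (fun r : ℝ => r ^ 2 / (4 * β)) (Set.Ioo 0 (2 * √β)) := by
    intro r hr s hs h
    simp only at h
    rw [div_left_inj' (by positivity)] at h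
    exact (pow_left_inj₀ hr.1.le hs.1.le two_ne_zero).1 h
  rw [← himg, lintegral_image_eq_lintegral_abs_deriv_mul measurableSet_Ioo
    (f' := fun r => r / (2 * β)) (fun r _ => by
      refine (((hasDerivAt_pow 2 r).div_const (4 * β)).congr_deriv ?_).hasDerivWithinAt
      simp only [Nat.cast_ofNat, Nat.add_one_sub_one, pow_one]
      field_simp
      ring) hinj]
  refine setLIntegral_congr_fun measurableSet_Ioo fun r hr => ?_
  rw [abs_of_pos (div_pos hr.1 (by positivity)), show β * (r ^ 2 / (4 * β)) = (r / 2) ^ 2 by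
    field_simp; norm_num, Real.sqrt_sq (half_pos hr.1).le, mul_div_cancel₀ _ two_ne_zero]

/-- The marginal of Lebesgue measure on a disc, in polar and in Cartesian coordinates. -/
theorem lintegral_polar_disc {R : ℝ} (hR : 0 < R) {f : ℝ → ℝ≥0∞} (hf : Measurable f) :
    ∫⁻ r in Set.Ioo 0 R, ENNReal.ofReal r *
        ∫⁻ θ in Set.Ioo (-Real.pi) Real.pi, f (r * Real.cos θ) =
      ∫⁻ x, ENNReal.ofReal (2 * √(R ^ 2 - x ^ 2)) * f x := by
  -- The function `f(x)` cut off to the open disc is integrated in two ways; the vertical chord at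
  -- `x` has length `2√(R² - x²)`.
  set F : ℝ × ℝ → ℝ≥0∞ := {p : ℝ × ℝ | p.1 ^ 2 + p.2 ^ 2 < R ^ 2}.indicator fun p => f p.1
  have hF : Measurable F := (hf.comp measurable_fst).indicator
    (measurableSet_lt (by fun_prop) measurable_const)
  have h := lintegral_comp_polarCoord_symm F
  have hpolar : ∫⁻ p in polarCoord.target, ENNReal.ofReal p.1 • F (polarCoord.symm p) =
      ∫⁻ r in Set.Ioo 0 R, ENNReal.ofReal r *
        ∫⁻ θ in Set.Ioo (-Real.pi) Real.pi, f (r * Real.cos θ) := by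
    have hm : Measurable fun p : ℝ × ℝ => ENNReal.ofReal p.1 • F (polarCoord.symm p) :=
      (measurable_fst.ennreal_ofReal).smul (hF.comp continuous_polarCoord_symm.measurable)
    rw [polarCoord_target, Measure.volume_eq_prod, ← Measure.prod_restrict,
      lintegral_prod _ hm.aemeasurable,
      show Set.Ioo 0 R = Set.Iio R ∩ Set.Ioi 0 by rw [Set.inter_comm, Set.Ioi_inter_Iio], ← Measure.restrict_restrict measurableSet_Iio, ← lintegral_indicator measurableSet_Iio]
    refine setLIntegral_congr_fun measurableSet_Ioi fun r hr => ?_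
    have hFr : ∀ θ, F (polarCoord.symm (r, θ)) =
        (Set.Iio R).indicator (fun r => f (r * Real.cos θ)) r := fun θ => by
      have hiff : (r * Real.cos θ) ^ 2 + (r * Real.sin θ) ^ 2 < R ^ 2 ↔ r < R := by
        rw [mul_pow, mul_pow, ← mul_add, Real.cos_sq_add_sin_sq, mul_one]
        exact pow_lt_pow_iff_left₀ (le_of_lt hr) hR.le two_ne_zero
      simp only [F, polarCoord_symm_apply]
      by_cases hrR : r < R
      · rw [Set.indicator_of_mem (by exact hiff.2 hrR), Set.indicator_of_mem (by exact hrR)]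
      · rw [Set.indicator_of_notMem (by exact fun h => hrR (hiff.1 h)),
          Set.indicator_of_notMem (by exact hrR)]
    simp only [hFr, smul_eq_mul]
    rw [lintegral_const_mul' _ _ ENNReal.ofReal_ne_top]
    by_cases hrR : r < R
    · simp only [Set.indicator_of_mem (Set.mem_Iio.2 hrR)]
    · simp only [Set.indicator_of_notMem (fun h => hrR (Set.mem_Iio.1 h)), lintegral_zero,
        mul_zero]
  rw [← hpolar, h, Measure.volume_eq_prod, lintegral_prod _ hF.aemeasurable]
  refine lintegral_congr fun x => ?_
  -- For `|x| ≥ R` the real square root is `0` and the interval is empty, so no case distinction is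
  -- needed.
  have hFx : ∀ y, F (x, y) = (Set.Ioo (-√(R ^ 2 - x ^ 2)) √(R ^ 2 - x ^ 2)).indicator
      (fun _ => f x) y := fun y => by
    have hiff : x ^ 2 + y ^ 2 < R ^ 2 ↔ y ∈ Set.Ioo (-√(R ^ 2 - x ^ 2)) √(R ^ 2 - x ^ 2) := by
      rw [Set.mem_Ioo, ← Real.sq_lt]
      constructor <;> intro h <;> linarith
    by_cases hy : x ^ 2 + y ^ 2 < R ^ 2
    · rw [Set.indicator_of_mem (hiff.1 hy)]
      exact Set.indicator_of_mem (by exact hy) _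
    · rw [Set.indicator_of_notMem (fun h => hy (hiff.2 h))]
      exact Set.indicator_of_notMem (by exact hy) _
  simp only [hFx]
  rw [lintegral_indicator_const measurableSet_Ioo, Real.volume_Ioo, mul_comm]
  congr 2
  ring

/-- The semicircle density is the chord length of the disc of radius `2√β` divided by its area
`4πβ`. -/
theorem semicircleLaw_apply {β : ℝ} (hβ : 0 < β) {X : Set ℝ} (hX : MeasurableSet X) :
    semicircleLaw β X = (ENNReal.ofReal (4 * Real.pi * β))⁻¹ *
      ∫⁻ x, ENNReal.ofReal (2 * √((2 * √β) ^ 2 - x ^ 2)) * X.indicator 1 x := by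
  have hsq : (2 * √β) ^ 2 = 4 * β := by rw [mul_pow, Real.sq_sqrt hβ.le]; norm_num
  have hpos : 0 < 4 * Real.pi * β := by have := Real.pi_pos; positivity
  rw [semicircleLaw, withDensity_apply _ hX, ← lintegral_indicator hX,
    ← lintegral_const_mul' _ _ (ENNReal.inv_ne_top.2 (by simpa using hpos)), ]
  refine lintegral_congr fun x => ?_
  by_cases hx : x ∈ X
  swap
  · simp [hx]
  rw [Set.indicator_of_mem hx, Set.indicator_of_mem hx, Pi.one_apply, mul_one,
    ← ENNReal.ofReal_inv_of_pos hpos, ← ENNReal.ofReal_mul (by positivity), hsq]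
  congr 1
  by_cases hxR : x ∈ Set.Icc (-(2 * √β)) (2 * √β)
  · rw [Set.indicator_of_mem hxR]
    field_simp
    ring
  -- Outside the interval the radicand is nonpositive, so the chord length already vanishes.
  · rw [Set.indicator_of_notMem hxR, Real.sqrt_eq_zero_of_nonpos, mul_zero, mul_zero]
    rw [← hsq]
    by_contra! h
    have := abs_lt_of_sq_lt_sq (by linarith : x ^ 2 < (2 * √β) ^ 2) (by positivity)
    exact hxR ⟨(abs_lt.1 this).1.le, (abs_lt.1 this).2.le⟩

theorem isExpectedSpectralMeasure_semicircleLaw {β : ℝ} (hβ : 0 < β) :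
    IsExpectedSpectralMeasure (fun u : unitInterval => integerLine √(β * u)) volume
      (semicircleLaw β) := by
  refine ⟨fun u => (AddCircle.haarAddCircle (T := 2 * Real.pi)).map (lineSymbol √(β * u)),
    (measurable_map_lineSymbol β).aemeasurable,
    Eventually.of_forall fun u => isSpectralMeasure_integerLine _, fun X hX => ?_⟩
  have hπ : 0 < Real.pi := Real.pi_pos
  have hmeas : Measurable (X.indicator (1 : ℝ → ℝ≥0∞)) := measurable_one.indicator hX
  have h₁ : ∀ c, (AddCircle.haarAddCircle (T := 2 * Real.pi)).map (lineSymbol c) X =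
      (ENNReal.ofReal (2 * Real.pi))⁻¹ * ∫⁻ θ in Set.Ioo (-Real.pi) Real.pi,
        X.indicator 1 (2 * c * Real.cos θ) := fun c => by
    rw [← lintegral_haarAddCircle_lineSymbol, ← lintegral_indicator_one hX,
      lintegral_map hmeas (measurable_lineSymbol c)]
  simp only [h₁]
  have h₂ : ∀ g : ℝ → ℝ≥0∞, ∫⁻ u : unitInterval, g u = ∫⁻ u in Set.Ioo (0 : ℝ) 1, g u :=
    fun g => by
    rw [setLIntegral_congr Ioo_ae_eq_Icc]
    exact unitInterval.measurePreserving_coe.lintegral_comp_emb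
      unitInterval.measurableEmbedding_coe g
  rw [h₂ fun u => (ENNReal.ofReal (2 * Real.pi))⁻¹ * ∫⁻ θ in Set.Ioo (-Real.pi) Real.pi,
        X.indicator 1 (2 * √(β * u) * Real.cos θ),
    lintegral_Ioo_eq_lintegral_sq hβ fun r => (ENNReal.ofReal (2 * Real.pi))⁻¹ *
      ∫⁻ θ in Set.Ioo (-Real.pi) Real.pi, X.indicator 1 (r * Real.cos θ),
    semicircleLaw_apply hβ hX, ← lintegral_polar_disc (by positivity) hmeas,
    ← lintegral_const_mul' _ _ (ENNReal.inv_ne_top.2 (by simpa using by positivity))]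
  refine setLIntegral_congr_fun measurableSet_Ioo fun r hr => ?_
  rw [← mul_assoc, ← mul_assoc]
  congr 1
  -- The radial density `r / (2β)` times the angular density `1 / (2π)` is `r / (4πβ)`, the uniform
  -- density in polar coordinates.
  rw [← ENNReal.ofReal_inv_of_pos (by positivity), ← ENNReal.ofReal_inv_of_pos (by positivity),
    ← ENNReal.ofReal_mul (by positivity), ← ENNReal.ofReal_mul (div_nonneg hr.1.le (by positivity))]
  congr 1
  field_simp
  ring

/-- The β-Hermite matrices of sizes `n + 1 = 1, 2, 3, …` are realised on a probability space
`(Ω, P)`, `X n` being the entries of the matrix of size `n + 1`; nothing is assumed on the joint law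
of matrices of different sizes. -/
theorem theorem1 (β : ℝ) (hβ : 0 < β) {Ω : Type*} [MeasurableSpace Ω] (P : Measure Ω)
    [IsProbabilityMeasure P] (X : ∀ n : ℕ, Ω → (Fin (n + 1) → ℝ) × (Fin n → ℝ))
    (hX : ∀ n, HasLaw (X n) (hermiteEntriesLaw β n) P) :
    -- convergence of the law with respect to the randomness of the matrix and of the root
    BenjaminiSchrammConverges
      (fun n (p : Ω × Fin (n + 1)) => tridiagRootedGraph (X n p.1) p.2)
      (fun n => P.prod (uniformOn (Set.univ : Set (Fin (n + 1)))))
      (fun u : unitInterval => integerLine √(β * u)) volume ∧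
    -- for almost every realisation of the matrices, with respect to the choice of the root alone
    (∀ᵐ ω ∂P, BenjaminiSchrammConverges
      (fun n (o : Fin (n + 1)) => tridiagRootedGraph (X n ω) o)
      (fun n => uniformOn (Set.univ : Set (Fin (n + 1))))
      (fun u : unitInterval => integerLine √(β * u)) volume) ∧
    -- the expected spectral measure of the limit
    IsExpectedSpectralMeasure (fun u : unitInterval => integerLine √(β * u)) volume
      (semicircleLaw β) :=
  ⟨annealed_benjaminiSchrammConverges hβ hX, quenched_benjaminiSchrammConverges hβ hX,
    isExpectedSpectralMeasure_semicircleLaw hβ⟩
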